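/- Let $\mathcal F=\bigoplus_{n\ge 0}L^2_{\mathbb C}(\mathbb R_+)^{\otimes n}=\bigoplus_{n\ge0}L^2_{\mathbb C}(\mathbb R_+^n)$ be the full Fock space with vacuum vector $\Omega$, and for real $h\in L^2_{\mathbb R}(\mathbb R_+)$ let $S(h)=l(h)+l(h)^*$ be the semicircular operator, where $l(h)$ is the left creation operator. Let $\mathcal{SC}=\{S(h):h\in L^2_{\mathbb R}(\mathbb R_+)\}''$ be the von Neumann algebra generated by the free Brownian motion, with the vacuum trace $\tau(X)=\langle\Omega,X\Omega\rangle$, and identify $L^2(\mathcal{SC},\tau)$ with the closure of $\mathcal{SC}\,\Omega$ in $\mathcal F$ via $X\mapsto X\Omega$. Let $\mathcal P_n\subset L^2(\mathcal{SC},\tau)$ be the closed span of the products $S(h_1)\cdots S(h_k)$, $0\le k\le n$ (the empty product being $1$), and let $\mathcal H_0=\mathcal P_0$ and $\mathcal H_n=\mathcal P_n\ominus\mathcal P_{n-1}$ for $n\ge 1$ (the homogeneous Wigner chaos of order $n$). Let $\nabla$ be the free Malliavin derivative, i.e. the derivation on the unital $*$-algebra $\mathcal{SC}_{alg}$ generated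 by the $S(h)$ with $\nabla_t S(h)=h(t)\,1\otimes 1$ and $\nabla(FG)=F\cdot\nabla G+\nabla F\cdot G$, where the left action multiplies the left leg on the left and the right action multiplies the right leg on the right. Let $\nabla^p_{t_1,\dots,t_p}=(\mathrm{id}^{\otimes(p-1)}\otimes\nabla_{t_p})\circ\cdots\circ(\mathrm{id}\otimes\nabla_{t_2})\circ\nabla_{t_1}$ on $\mathcal{SC}_{alg}$, and denote by the same symbol $\nabla^p$ its closure as an unbounded operator from $L^2(\mathcal{SC},\tau)$ to $L^2(\mathbb R_+^p,L^2(\mathcal{SC}^{\otimes(p+1)},\tau^{\otimes(p+1)}))$. The maps $\mathrm{id}\otimes\tau^{\otimes p}$ and $\tau^{\otimes p}\otimes\mathrm{id}$ are extended by continuity to $L^2(\mathcal{SC}^{\otimes(p+1)},\tau^{\otimes (p+1)})\to L^2(\mathcal{SC},\tau)$. **Lemma (Generalized Cébron formulas).** Let $b\ge a\ge p>1$ be integers and let $A,B\in\bigoplus_{k=a}^b\mathcal H_k$. Then $A,B$ belong to $\mathcal{SC}$ and to the domain of $\nabla^p$; for almost every $(t_1,\dots,t_p)\in\mathbb R_+^p$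 the elements $(\mathrm{id}\otimes\tau^{\otimes p})(\nabla^p_{t_p,\dots,t_1}A)$ and $(\tau^{\otimes p}\otimes\mathrm{id})(\nabla^p_{t_1,\dots,t_p}B)$ of $L^2(\mathcal{SC},\tau)$ belong to $\mathcal{SC}$; their product is Bochner integrable over $\mathbb R_+^p$ in operator norm; and $$\tau(AB)=\tau\left(\int_{\mathbb R_+^p}(\mathrm{id}\otimes\tau^{\otimes p})(\nabla^p_{t_p,\dots,t_1}A)\cdot(\tau^{\otimes p}\otimes\mathrm{id})(\nabla^p_{t_1,\dots,t_p}B)\,dt_1\cdots dt_p\right).$$ -/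

import Mathlib

open MeasureTheory
open scoped ENNReal

noncomputable section

namespace Wigner

/-- Lebesgue measure on `ℝ₊ = [0, ∞)`, as a measure on `ℝ` carried by `[0, ∞)`. -/
def leb : Measure ℝ := volume.restrict (Set.Ici 0)

instance : SigmaFinite leb := by unfold leb; infer_instance

/-- Lebesgue measure `dt₁ … dtₙ` on `ℝ₊ⁿ`. -/
abbrev lebPow (n : ℕ) : Measure (Fin n → ℝ) := Measure.pi fun _ => leb

/-- The real Hilbert space `L²_ℝ(ℝ₊)`. -/
abbrev RealL2 : Type := Lp ℝ 2 leb

/-- The inclusion of `L²_ℝ(ℝ₊)` in its complexification `L²_ℂ(ℝ₊)`. -/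
def toComplex (h : RealL2) : Lp ℂ 2 leb := Complex.ofRealCLM.compLp h

/-! ### The full Fock space over `L²_ℂ(ℝ₊)` -/

/-- The disjoint union `⊔ₙ ℝⁿ`. -/
abbrev Conf : Type := Σ n : ℕ, (Fin n → ℝ)

/-- The `n`-th piece `ℝⁿ ⊆ ⊔ₙ ℝⁿ`. -/
def piece (n : ℕ) (t : Fin n → ℝ) : Conf := ⟨n, t⟩

/-- The measure on `⊔ₙ ℝⁿ` that restricts to Lebesgue measure of `ℝ₊ⁿ` on the `n`-th piece
(a unit point mass for `n = 0`). -/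
def confMeasure : Measure Conf := Measure.sum fun n => (lebPow n).map (piece n)

/-- The full Fock space `⨁ₙ L²_ℂ(ℝ₊)^{⊗ n} = ⨁ₙ L²_ℂ(ℝ₊ⁿ) = L²(⊔ₙ ℝ₊ⁿ)` (Hilbert sum). -/
abbrev Fock : Type := Lp ℂ 2 confMeasure

lemma piece_injective (n : ℕ) : Function.Injective (piece n) :=
  fun _ _ h => eq_of_heq (Sigma.mk.inj h).2

lemma piece_preimage_ne {m n : ℕ} (h : m ≠ n) (s : Set (Fin n → ℝ)) :
    piece m ⁻¹' (piece n '' s) = ∅ := by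
  ext t
  simp only [piece, Set.mem_preimage, Set.mem_image, Set.mem_empty_iff_false, iff_false]
  rintro ⟨u, -, hu⟩
  exact h (congrArg Sigma.fst hu).symm

lemma measurable_piece (n : ℕ) : Measurable (piece n) := by
  intro s hs
  exact (MeasurableSpace.measurableSet_iInf.1 hs) n

lemma measurableSet_conf {s : Set Conf} (hs : ∀ n, MeasurableSet (piece n ⁻¹' s)) :
    MeasurableSet s :=
  MeasurableSpace.measurableSet_iInf.2 fun n => hs n

lemma measurableEmbedding_piece (n : ℕ) : MeasurableEmbedding (piece n) where
  injective := piece_injective n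
  measurable := measurable_piece n
  measurableSet_image' := by
    intro s hs
    refine measurableSet_conf fun m => ?_
    by_cases h : m = n
    · subst h
      rwa [Set.preimage_image_eq _ (piece_injective m)]
    · rw [piece_preimage_ne h]
      exact MeasurableSet.empty

lemma lintegral_conf (F : Conf → ℝ≥0∞) :
    ∫⁻ c, F c ∂confMeasure = ∑' n, ∫⁻ t, F (piece n t) ∂(lebPow n) := by
  unfold confMeasure
  rw [lintegral_sum_measure]
  exact tsum_congr fun n => (measurableEmbedding_piece n).lintegral_map _

lemma ae_conf {q : Conf → Prop} :
    (∀ᵐ c ∂confMeasure, q c) ↔ ∀ n, ∀ᵐ t ∂(lebPow n), q (piece n t) := by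
  unfold confMeasure
  rw [Measure.ae_sum_iff]
  exact forall_congr' fun n => (measurableEmbedding_piece n).ae_map_iff

lemma confMeasure_piece (n : ℕ) (s : Set (Fin n → ℝ)) :
    confMeasure (piece n '' s) = lebPow n s := by
  have hu : ∀ m, ((lebPow m).map (piece m)) (piece n '' s)
      = if m = n then lebPow n s else 0 := by
    intro m
    rw [(measurableEmbedding_piece m).map_apply]
    split_ifs with h
    · subst h
      rw [Set.preimage_image_eq _ (piece_injective m)]
    · rw [piece_preimage_ne h, measure_empty]
  unfold confMeasure
  rw [Measure.sum_apply_of_countable]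
  simp_rw [hu]
  simp

instance : SigmaFinite confMeasure := by
  refine Measure.sigmaFinite_of_countable
    (S := Set.range fun q : ℕ × ℕ => piece q.1 '' (spanningSets (lebPow q.1) q.2))
    (Set.countable_range _) ?_ ?_
  · rintro _ ⟨q, rfl⟩
    simpa only [confMeasure_piece] using measure_spanningSets_lt_top (lebPow q.1) q.2
  · ext ⟨n, t⟩
    simp only [Set.mem_univ, iff_true]
    refine ⟨_, ⟨(n, spanningSetsIndex (lebPow n) t), rfl⟩, t, ?_, rfl⟩
    exact mem_spanningSetsIndex _ _

lemma vacuumSet_eq : {c : Conf | c.1 = 0} = piece 0 '' Set.univ := by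
  ext ⟨n, t⟩
  simp only [Set.mem_ofPred_eq, Set.image_univ, Set.mem_range]
  constructor
  · rintro rfl
    exact ⟨t, rfl⟩
  · rintro ⟨u, hu⟩
    exact (congrArg Sigma.fst hu).symm

lemma measurableSet_vacuumSet : MeasurableSet {c : Conf | c.1 = 0} := by
  rw [vacuumSet_eq]
  exact (measurableEmbedding_piece 0).measurableSet_image.2 MeasurableSet.univ

lemma confMeasure_vacuumSet : confMeasure {c : Conf | c.1 = 0} = 1 := by
  rw [vacuumSet_eq, confMeasure_piece]
  simp

/-- The vacuum vector `Ω`: the constant `1` on the `0`-th piece. -/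
def vacuum : Fock :=
  indicatorConstLp 2 measurableSet_vacuumSet (by simp [confMeasure_vacuumSet]) (1 : ℂ)

lemma norm_vacuum : ‖vacuum‖ = 1 := by
  simp [vacuum, norm_indicatorConstLp, Measure.real, confMeasure_vacuumSet]

/-- `(h ⊗ ξ)(t₁, …, tₙ₊₁) = h(t₁) ξ(t₂, …, tₙ₊₁)`, with vanishing `0`-th component. -/
def creationFun (h : ℝ → ℂ) (ξ : Conf → ℂ) : Conf → ℂ
  | ⟨0, _⟩ => 0
  | ⟨n + 1, t⟩ => h (t 0) * ξ ⟨n, Fin.tail t⟩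

lemma mp_cons (n : ℕ) : MeasurePreserving
    (fun t : Fin (n + 1) → ℝ => (t 0, Fin.tail t)) (lebPow (n + 1)) (leb.prod (lebPow n)) :=
  measurePreserving_piFinSuccAbove (fun _ : Fin (n + 1) => leb) 0

lemma aestronglyMeasurable_conf {f : Conf → ℂ}
    (hf : ∀ n, AEStronglyMeasurable (fun t => f (piece n t)) (lebPow n)) :
    AEStronglyMeasurable f confMeasure := by
  unfold confMeasure
  rw [aestronglyMeasurable_sum_measure_iff]
  exact fun n => (measurableEmbedding_piece n).aestronglyMeasurable_map_iff.2 (hf n)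

lemma aestronglyMeasurable_piece {f : Conf → ℂ} (hf : AEStronglyMeasurable f confMeasure) (n : ℕ) :
    AEStronglyMeasurable (fun t => f (piece n t)) (lebPow n) := by
  unfold confMeasure at hf
  rw [aestronglyMeasurable_sum_measure_iff] at hf
  exact (measurableEmbedding_piece n).aestronglyMeasurable_map_iff.1 (hf n)

lemma eLpNorm_creationFun {h : ℝ → ℂ} {ξ : Conf → ℂ} (hh : AEStronglyMeasurable h leb)
    (hξ : AEStronglyMeasurable ξ confMeasure) :
    eLpNorm (creationFun h ξ) 2 confMeasure = eLpNorm h 2 leb * eLpNorm ξ 2 confMeasure := by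
  have key : ∀ n, ∫⁻ t, ‖creationFun h ξ (piece (n + 1) t)‖ₑ ^ (2 : ℝ) ∂(lebPow (n + 1))
      = (∫⁻ s, ‖h s‖ₑ ^ (2 : ℝ) ∂leb) * ∫⁻ t, ‖ξ (piece n t)‖ₑ ^ (2 : ℝ) ∂(lebPow n) := by
    intro n
    have hm1 := hh.enorm.pow_const (2 : ℝ)
    have hm2 := (aestronglyMeasurable_piece hξ n).enorm.pow_const (2 : ℝ)
    rw [← lintegral_prod_mul hm1 hm2]
    have hm3 : AEMeasurable (fun z : ℝ × (Fin n → ℝ) =>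
        ‖h z.1‖ₑ ^ (2 : ℝ) * ‖ξ (piece n z.2)‖ₑ ^ (2 : ℝ)) (leb.prod (lebPow n)) :=
      (hm1.comp_quasiMeasurePreserving Measure.quasiMeasurePreserving_fst).mul
        (hm2.comp_quasiMeasurePreserving Measure.quasiMeasurePreserving_snd)
    rw [← (mp_cons n).map_eq] at hm3 ⊢
    rw [lintegral_map' hm3 (mp_cons n).measurable.aemeasurable]
    refine lintegral_congr fun t => ?_
    simp only [creationFun, piece, enorm_mul]
    exact ENNReal.mul_rpow_of_nonneg _ _ (by norm_num)
  have h2 : (2 : ℝ≥0∞) ≠ 0 := by norm_num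
  have h2' : (2 : ℝ≥0∞) ≠ ∞ := by norm_num
  rw [eLpNorm_eq_lintegral_rpow_enorm_toReal h2 h2', eLpNorm_eq_lintegral_rpow_enorm_toReal h2 h2',
    eLpNorm_eq_lintegral_rpow_enorm_toReal h2 h2']
  simp only [ENNReal.toReal_ofNat]
  rw [← ENNReal.mul_rpow_of_nonneg _ _ (by norm_num)]
  congr 1
  rw [lintegral_conf, lintegral_conf, tsum_eq_zero_add' ENNReal.summable]
  simp only [key]
  rw [ENNReal.tsum_mul_left]
  simp [creationFun, piece]

lemma memLp_creationFun (h : Lp ℂ 2 leb) (ξ : Fock) :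
    MemLp (creationFun h ξ) 2 confMeasure := by
  refine ⟨aestronglyMeasurable_conf fun n => ?_, ?_⟩
  · cases n with
    | zero => exact aestronglyMeasurable_const (b := (0 : ℂ))
    | succ n =>
      have h1 := ((Lp.aestronglyMeasurable h).comp_quasiMeasurePreserving
        Measure.quasiMeasurePreserving_fst).mul
        ((aestronglyMeasurable_piece (Lp.aestronglyMeasurable ξ) n).comp_quasiMeasurePreserving
          (Measure.quasiMeasurePreserving_snd (μ := leb)))
      exact h1.comp_measurePreserving (mp_cons n)
  · rw [eLpNorm_creationFun (Lp.aestronglyMeasurable h) (Lp.aestronglyMeasurable ξ)]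
    exact ENNReal.mul_lt_top (Lp.eLpNorm_lt_top h) (Lp.eLpNorm_lt_top ξ)

lemma creationFun_congr (h : ℝ → ℂ) {ξ η : Conf → ℂ} (e : ξ =ᵐ[confMeasure] η) :
    creationFun h ξ =ᵐ[confMeasure] creationFun h η := by
  refine ae_conf.2 fun n => ?_
  cases n with
  | zero => exact Filter.Eventually.of_forall fun t => rfl
  | succ n =>
    have q := (Measure.quasiMeasurePreserving_snd (μ := leb) (ν := lebPow n)).comp
      (mp_cons n).quasiMeasurePreserving
    filter_upwards [q.ae (ae_conf.1 e n)] with t ht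
    exact congrArg (fun z => h (t 0) * z) ht

/-- The left creation operator `l(h)`. -/
def creation (h : Lp ℂ 2 leb) : Fock →L[ℂ] Fock :=
  LinearMap.mkContinuous
    { toFun := fun ξ => (memLp_creationFun h ξ).toLp _
      map_add' := by
        intro ξ η
        rw [← MemLp.toLp_add, MemLp.toLp_eq_toLp_iff]
        refine (creationFun_congr h (Lp.coeFn_add ξ η)).trans (Filter.Eventually.of_forall ?_)
        rintro ⟨_ | n, t⟩ <;> simp [creationFun, mul_add]
      map_smul' := by
        intro c ξ
        rw [RingHom.id_apply, ← MemLp.toLp_const_smul, MemLp.toLp_eq_toLp_iff]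
        refine (creationFun_congr h (Lp.coeFn_smul c ξ)).trans (Filter.Eventually.of_forall ?_)
        rintro ⟨_ | n, t⟩ <;> simp [creationFun, mul_left_comm] }
    ‖h‖ (by
      intro ξ
      simp only [LinearMap.coe_mk, AddHom.coe_mk, Lp.norm_toLp]
      rw [eLpNorm_creationFun (Lp.aestronglyMeasurable h) (Lp.aestronglyMeasurable ξ),
        ENNReal.toReal_mul, Lp.norm_def, Lp.norm_def])

/-- The semicircular operator `S(h) = l(h) + l(h)*`, for `h` real. -/
def semicircular (h : RealL2) : Fock →L[ℂ] Fock :=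
  creation (toComplex h) + ContinuousLinearMap.adjoint (creation (toComplex h))

/-- The von Neumann algebra `𝒮𝒞 = {S(h) : h ∈ L²_ℝ(ℝ₊)}''`. -/
def SC : VonNeumannAlgebra Fock where
  toStarSubalgebra := StarSubalgebra.centralizer ℂ
    (StarSubalgebra.centralizer ℂ (Set.range semicircular) : Set (Fock →L[ℂ] Fock))
  centralizer_centralizer' := by
    simp

/-- The vacuum state `τ(X) = ⟨Ω, X Ω⟩` (Mathlib's inner product is linear on the right). -/
def tau (X : Fock →L[ℂ] Fock) : ℂ := inner ℂ vacuum (X vacuum)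

/-! ### `L²(𝒮𝒞, τ)` and the Wigner chaoses

The space `L²(𝒮𝒞, τ)` is realised in the usual way inside the Fock space, as the closure of
`𝒮𝒞 Ω`; the operator `X` is identified with the vector `X Ω`, and
`τ(Y* X) = ⟨Y Ω, X Ω⟩`. -/

/-- The monomial `S(h₁) ⋯ S(hₙ)`. -/
def wordOp (w : List RealL2) : Fock →L[ℂ] Fock := (w.map semicircular).prod

/-- The monomial `S(h₁) ⋯ S(hₙ)` as an element of `L²(𝒮𝒞, τ)`. -/
def wordVec (w : List RealL2) : Fock := wordOp w vacuum

/-- The chaos `𝒫ₙ`: the closed span in `L²(𝒮𝒞, τ)` of the monomials of degree at most `n`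
(including `1`). -/
def chaosLE (n : ℕ) : Submodule ℂ Fock :=
  (Submodule.span ℂ (wordVec '' {w | w.length ≤ n})).topologicalClosure

/-- The homogeneous chaos `ℋₙ = 𝒫ₙ ⊖ 𝒫ₙ₋₁`, with `ℋ₀ = 𝒫₀`. -/
def chaos : ℕ → Submodule ℂ Fock
  | 0 => chaosLE 0
  | n + 1 => chaosLE (n + 1) ⊓ (chaosLE n)ᗮ

/-- `ξ ∈ L²(𝒮𝒞, τ)` belongs to `𝒮𝒞`, that is, `ξ = X Ω` for some `X ∈ 𝒮𝒞`. -/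
def IsBoundedElement (ξ : Fock) : Prop := ∃ X ∈ SC, X vacuum = ξ

open Classical in
/-- The operator `X ∈ 𝒮𝒞` with `X Ω = ξ`, for `ξ` in `𝒮𝒞 ⊆ L²(𝒮𝒞, τ)`
(it is unique, since `Ω` is separating for `𝒮𝒞`). -/
def toOp (ξ : Fock) : Fock →L[ℂ] Fock :=
  if h : IsBoundedElement ξ then h.choose else 0

/-! ### Hilbert tensor powers -/

section TensorPower

variable {α : Type*} [MeasurableSpace α] {μ : Measure α} [SigmaFinite μ] {n : ℕ}

lemma memLp_pureTensor (f : Fin n → Lp ℂ 2 μ) :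
    MemLp (fun x : Fin n → α => ∏ j, f j (x j)) 2 (Measure.pi fun _ => μ) := by
  have hm : AEStronglyMeasurable (fun x : Fin n → α => ∏ j, f j (x j))
      (Measure.pi fun _ => μ) := by
    have := Finset.aestronglyMeasurable_prod (M := ℂ) (μ := Measure.pi fun _ : Fin n => μ)
      Finset.univ (f := fun j x => f j (x j)) fun j _ =>
      (Lp.aestronglyMeasurable (f j)).comp_quasiMeasurePreserving
        (Measure.quasiMeasurePreserving_eval (fun _ : Fin n => μ) j)
    simpa [Finset.prod_fn] using this
  rw [memLp_two_iff_integrable_sq_norm hm]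
  simp only [norm_prod, ← Finset.prod_pow]
  exact Integrable.fintype_prod fun j =>
    (memLp_two_iff_integrable_sq_norm (Lp.aestronglyMeasurable (f j))).1 (Lp.memLp (f j))

/-- The elementary tensor `f₁ ⊗ ⋯ ⊗ fₙ` in `L²(μ)^{⊗ n} = L²(μ^{⊗ n})`. -/
def pureTensor (f : Fin n → Lp ℂ 2 μ) : Lp ℂ 2 (Measure.pi fun _ : Fin n => μ) :=
  (memLp_pureTensor f).toLp _

lemma inner_pureTensor (f g : Fin n → Lp ℂ 2 μ) :
    inner ℂ (pureTensor f) (pureTensor g) = ∏ j, inner ℂ (f j) (g j) := by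
  simp only [L2.inner_def]
  rw [← integral_fintype_prod_eq_prod (fun j x => inner ℂ (f j x) (g j x))]
  refine integral_congr_ae ?_
  filter_upwards [(memLp_pureTensor f).coeFn_toLp, (memLp_pureTensor g).coeFn_toLp] with x h1 h2
  unfold pureTensor
  rw [h1, h2]
  simp [RCLike.inner_apply, Finset.prod_mul_distrib]

lemma pureTensor_update_add (f : Fin n → Lp ℂ 2 μ) (j : Fin n) (ξ η : Lp ℂ 2 μ) :
    pureTensor (Function.update f j (ξ + η))
      = pureTensor (Function.update f j ξ) + pureTensor (Function.update f j η) := by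
  unfold pureTensor
  rw [← MemLp.toLp_add, MemLp.toLp_eq_toLp_iff]
  filter_upwards [(Measure.quasiMeasurePreserving_eval (fun _ : Fin n => μ) j).ae
    (Lp.coeFn_add ξ η)] with x hx
  simp only [Pi.add_apply, Function.eval] at hx ⊢
  rw [← Finset.mul_prod_erase _ _ (Finset.mem_univ j),
    ← Finset.mul_prod_erase _ _ (Finset.mem_univ j),
    ← Finset.mul_prod_erase _ _ (Finset.mem_univ j)]
  simp only [Function.update_self, hx, add_mul]
  congr 2 <;> exact Finset.prod_congr rfl fun i hi => by
    simp [Function.update_of_ne (Finset.ne_of_mem_erase hi)]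

lemma pureTensor_update_smul (f : Fin n → Lp ℂ 2 μ) (j : Fin n) (c : ℂ) (ξ : Lp ℂ 2 μ) :
    pureTensor (Function.update f j (c • ξ)) = c • pureTensor (Function.update f j ξ) := by
  unfold pureTensor
  rw [← MemLp.toLp_const_smul, MemLp.toLp_eq_toLp_iff]
  filter_upwards [(Measure.quasiMeasurePreserving_eval (fun _ : Fin n => μ) j).ae
    (Lp.coeFn_smul c ξ)] with x hx
  simp only [Pi.smul_apply, Function.eval, smul_eq_mul] at hx ⊢
  rw [← Finset.mul_prod_erase _ _ (Finset.mem_univ j),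
    ← Finset.mul_prod_erase _ _ (Finset.mem_univ j)]
  simp only [Function.update_self, hx, mul_assoc]
  congr 2
  exact Finset.prod_congr rfl fun i hi => by
    simp [Function.update_of_ne (Finset.ne_of_mem_erase hi)]

end TensorPower

/-- The Hilbert tensor power `Fock^{⊗ n}`; it contains `L²(𝒮𝒞^{⊗ n}, τ^{⊗ n})`, the operator
`X₁ ⊗ ⋯ ⊗ Xₙ` being identified with the vector `X₁ Ω ⊗ ⋯ ⊗ Xₙ Ω`. -/
abbrev FockPow (n : ℕ) : Type := Lp ℂ 2 (Measure.pi fun _ : Fin n => confMeasure)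

/-- `ξ ↦ Ω ⊗ ⋯ ⊗ ξ ⊗ ⋯ ⊗ Ω`, with `ξ` on the `j`-th leg. -/
def insertLeg {n : ℕ} (j : Fin n) : Fock →L[ℂ] FockPow n :=
  LinearMap.mkContinuous
    { toFun := fun ξ => pureTensor (Function.update (fun _ => vacuum) j ξ)
      map_add' := fun ξ η => pureTensor_update_add _ j ξ η
      map_smul' := fun c ξ => pureTensor_update_smul _ j c ξ }
    1 (by
      intro ξ
      have h : ‖pureTensor (Function.update (fun _ => vacuum) j ξ)‖ ^ 2 = ‖ξ‖ ^ 2 := by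
        have h1 := inner_pureTensor (Function.update (fun _ => vacuum) j ξ)
          (Function.update (fun _ => vacuum) j ξ)
        simp only [inner_self_eq_norm_sq_to_K] at h1
        rw [Finset.prod_eq_single j] at h1
        · rw [Function.update_self] at h1
          exact_mod_cast h1
        · intro i _ hi
          simp [Function.update_of_ne hi, norm_vacuum]
        · simp
      rw [one_mul]
      exact le_of_eq ((sq_eq_sq₀ (norm_nonneg _) (norm_nonneg _)).1 h))

/-- The slice map `τ ⊗ ⋯ ⊗ id ⊗ ⋯ ⊗ τ` that applies `τ` to every leg except the `j`-th,
`x₁ ⊗ ⋯ ⊗ xₙ ↦ (∏_{i ≠ j} τ(xᵢ)) xⱼ`, extended to `L²` (it is the adjoint of the inclusion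
`x ↦ 1 ⊗ ⋯ ⊗ x ⊗ ⋯ ⊗ 1`). -/
def slice {n : ℕ} (j : Fin n) : FockPow n →L[ℂ] Fock :=
  ContinuousLinearMap.adjoint (insertLeg j)

lemma slice_pureTensor {n : ℕ} (j : Fin n) (ξ : Fin n → Fock) :
    slice j (pureTensor ξ) = (∏ i ∈ Finset.univ.erase j, inner ℂ vacuum (ξ i)) • ξ j := by
  refine ext_inner_left ℂ fun η => ?_
  rw [slice, ContinuousLinearMap.adjoint_inner_right, inner_smul_right]
  change inner ℂ (pureTensor (Function.update (fun _ => vacuum) j η)) (pureTensor ξ) = _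
  rw [inner_pureTensor, ← Finset.mul_prod_erase _ _ (Finset.mem_univ j), Function.update_self,
    mul_comm]
  congr 1
  exact Finset.prod_congr rfl fun i hi => by
    rw [Function.update_of_ne (Finset.ne_of_mem_erase hi)]

/-! ### The iterated free Malliavin derivative -/

/-- The space `L²(ℝ₊^p, L²(𝒮𝒞^{⊗ (p+1)}))` of square integrable multiprocesses (inside
`L²(ℝ₊^p, Fock^{⊗ (p+1)})`). -/
abbrev MultiProcess (p : ℕ) : Type := Lp (FockPow (p + 1)) 2 (lebPow p)

/-- The multiprocess `(t₁, …, t_p) ↦ h₁(t₁) ⋯ h_p(t_p) · x₀ ⊗ ⋯ ⊗ x_p`. -/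
def elementary {p : ℕ} (h : Fin p → RealL2) (x : Fin (p + 1) → Fock) : MultiProcess p :=
  (ContinuousLinearMap.toSpanSingleton ℂ (pureTensor x)).compLp
    (pureTensor fun j => toComplex (h j))

/-- The terms of `∇ (S(h₁) ⋯ S(hₙ)) = ∑ₖ hₖ · S(h₁) ⋯ S(hₖ₋₁) ⊗ S(hₖ₊₁) ⋯ S(hₙ)`,
obtained from `∇ 1 = 0` and from the Leibniz rule
`∇ (S(h) F) = h · 1 ⊗ F + S(h) · ∇ F`. -/
def cuts : List RealL2 → List (List RealL2 × RealL2 × List RealL2)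
  | [] => []
  | h :: w => ([], h, w) :: (cuts w).map fun c => (h :: c.1, c.2)

/-- The general Leibniz rule `∇ (F G) = ∇ F · G + F · ∇ G` on monomials. -/
lemma cuts_append (v w : List RealL2) :
    cuts (v ++ w) = (cuts v).map (fun c => (c.1, c.2.1, c.2.2 ++ w))
      ++ (cuts w).map (fun c => (v ++ c.1, c.2)) := by
  induction v with
  | nil => simp [cuts]
  | cons h v ih => simp [cuts, ih, Function.comp_def]

/-- The terms of `∇^p` on a monomial. The first derivative acts in the variable `t₁`, and the
remaining ones, in the variables `t₂, …`, act successively on the last leg: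
`∇^p_{t₁, …, t_p} = (id^{⊗ (p-1)} ⊗ ∇_{t_p}) ∘ ⋯ ∘ (id ⊗ ∇_{t₂}) ∘ ∇_{t₁}`. -/
def iterCuts : (p : ℕ) → List RealL2 → List ((Fin p → RealL2) × (Fin (p + 1) → List RealL2))
  | 0, w => [(Fin.elim0, fun _ => w)]
  | p + 1, w => (cuts w).flatMap fun c =>
      (iterCuts p c.2.2).map fun d => (Fin.cons c.2.1 d.1, Fin.cons c.1 d.2)

/-- `∇^p (S(h₁) ⋯ S(hₙ))`. -/
def nablaWord (p : ℕ) (w : List RealL2) : MultiProcess p :=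
  ((iterCuts p w).map fun d => elementary d.1 fun j => wordVec (d.2 j)).sum

/-- The derivative `∇^p` on the unital `*`-algebra generated by the `S(h)`, extended linearly
from the monomials, as a densely defined operator on `L²(𝒮𝒞, τ)`. -/
def nablaAlg (p : ℕ) : Fock →ₗ.[ℂ] MultiProcess p :=
  (Submodule.span ℂ (Set.range fun w => (wordVec w, nablaWord p w))).toLinearPMap

/-- The iterated free Malliavin derivative `∇^p`, as a closed operator from `L²(𝒮𝒞, τ)` to
`L²(ℝ₊^p, L²(𝒮𝒞^{⊗ (p+1)}))`. -/
def nabla (p : ℕ) : Fock →ₗ.[ℂ] MultiProcess p := (nablaAlg p).closure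

end Wigner

end

open Wigner

open MeasureTheory
open scoped ENNReal

noncomputable section

namespace Wigner

/-! ### Creation and annihilation operators -/

/-! On elementary tensors both sides of the formula read a word backwards. If X ∈ 𝒮𝒞 is the Wick
product with X Ω = h₁ ⊗ ⋯ ⊗ hₘ, only its purely annihilating part contributes to τ(XY), so τ(XY) =
⟨hₘ ⊗ ⋯ ⊗ h₁, Y Ω⟩ (`inner_vacuum_wick`). On tensors ∇^p deletes p letters and its adjoint reinserts
them (`inner_elementary_nablaTens`). Applying τ to every leg but the first keeps only the term that
deletes the last p letters, which exists exactly when m ≥ p (`sum_iterCuts_vacuum_succ`). After time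
reversal, pairing this term with the last-leg slice of ∇^p B puts hₘ, …, hₘ₋ₚ₊₁ back in front of
hₘ₋ₚ, …, h₁: the reversed word again (`slicePairing_bvec`).

The rest is continuity on vectors of bounded order. The Haagerup inequality (`norm_wickBasis_le`)
bounds the operator norm by the L² norm there, so these vectors lie in 𝒮𝒞 and a product of two L²
processes is integrable in operator norm. The adjoint formula makes ∇^p closable (`graph_nabla`) and
bounded on orders at most n (`norm_nablaBasis_le`). Both sides become bounded bilinear forms, and
agreement on basis vectors suffices (`slicePairing_eq_tauForm`). The operator attached to a vector
is unique because the vacuum is separating (`eq_zero_of_apply_vacuum`). -/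

lemma coeFn_creation (h : Lp ℂ 2 leb) (ξ : Fock) :
    (creation h ξ : Conf → ℂ) =ᵐ[confMeasure] creationFun h ξ :=
  (memLp_creationFun h ξ).coeFn_toLp

lemma creationFun_congr_left {h k : ℝ → ℂ} (e : h =ᵐ[leb] k) (ξ : Conf → ℂ) :
    creationFun h ξ =ᵐ[confMeasure] creationFun k ξ := by
  refine ae_conf.2 fun n => ?_
  cases n with
  | zero => exact Filter.Eventually.of_forall fun t => rfl
  | succ n =>
    have q := (Measure.quasiMeasurePreserving_fst (μ := leb) (ν := lebPow n)).comp
      (mp_cons n).quasiMeasurePreserving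
    filter_upwards [q.ae e] with t ht
    exact congrArg (fun z => z * ξ ⟨n, Fin.tail t⟩) ht

lemma norm_creation_apply (h : Lp ℂ 2 leb) (ξ : Fock) : ‖creation h ξ‖ = ‖h‖ * ‖ξ‖ := by
  change ‖(memLp_creationFun h ξ).toLp _‖ = _
  rw [Lp.norm_toLp, eLpNorm_creationFun (Lp.aestronglyMeasurable h) (Lp.aestronglyMeasurable ξ),
    ENNReal.toReal_mul, Lp.norm_def, Lp.norm_def]

lemma creation_add (h k : Lp ℂ 2 leb) : creation (h + k) = creation h + creation k := by
  ext1 ξ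
  refine Lp.ext ?_
  rw [add_apply]
  refine (coeFn_creation _ _).trans (.trans ?_ (Lp.coeFn_add _ _).symm)
  refine .trans ?_ ((coeFn_creation h ξ).symm.add (coeFn_creation k ξ).symm)
  refine (creationFun_congr_left (Lp.coeFn_add h k) ξ).trans (Filter.Eventually.of_forall ?_)
  rintro ⟨_ | n, t⟩ <;> simp [creationFun, add_mul]

lemma creation_smul (c : ℂ) (h : Lp ℂ 2 leb) : creation (c • h) = c • creation h := by
  ext1 ξ
  refine Lp.ext ?_
  rw [smul_apply]
  refine (coeFn_creation _ _).trans (.trans ?_ (Lp.coeFn_smul _ _).symm)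
  refine .trans ?_ ((coeFn_creation h ξ).symm.const_smul c)
  refine (creationFun_congr_left (Lp.coeFn_smul c h) ξ).trans (Filter.Eventually.of_forall ?_)
  rintro ⟨_ | n, t⟩ <;> simp [creationFun, mul_assoc]

/-- Since l(h) multiplies norms by ‖h‖, the quadratic form of the difference of the two operators
vanishes, and over ℂ this forces the operator to vanish. -/
lemma adjoint_creation_self (h : Lp ℂ 2 leb) (ξ : Fock) :
    ContinuousLinearMap.adjoint (creation h) (creation h ξ) = (inner ℂ h h : ℂ) • ξ := by
  have := (inner_map_self_eq_zero
    ((ContinuousLinearMap.adjoint (creation h) * creation h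
      - (inner ℂ h h : ℂ) • (1 : Fock →L[ℂ] Fock)) : Fock →L[ℂ] Fock).toLinearMap).1 fun η => by
    simp only [ContinuousLinearMap.coe_coe, sub_apply,
      mul_apply_eq_comp, smul_apply,
      one_apply_eq_self, inner_sub_left, ContinuousLinearMap.adjoint_inner_left,
      inner_smul_left, inner_self_eq_norm_sq_to_K, norm_creation_apply]
    simp [mul_pow]
  have h2 := LinearMap.congr_fun this ξ
  simpa [sub_eq_zero] using h2

/-- `l(h)* l(k) = ⟨h, k⟩`. -/
lemma adjoint_creation_creation (h k : Lp ℂ 2 leb) (ξ : Fock) :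
    ContinuousLinearMap.adjoint (creation h) (creation k ξ) = (inner ℂ h k : ℂ) • ξ := by
  have h0 := adjoint_creation_self h ξ
  have h1 := adjoint_creation_self k ξ
  -- Polarisation: h + k yields the sum of the two cross terms and h + ik yields i times their
  -- difference, so adding -i times the second identity to the first isolates twice l(h)* l(k).
  have h2 := adjoint_creation_self (h + k) ξ
  have h3 := adjoint_creation_self (h + Complex.I • k) ξ
  simp only [creation_add, add_apply, map_add,
    inner_add_left, inner_add_right, add_smul, h0, h1, creation_smul, map_smulₛₗ,
    smul_apply, inner_smul_left, inner_smul_right,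
    smul_smul] at h2 h3
  simp only [Complex.conj_I, RingHom.id_apply] at h3
  have e2 := sub_eq_zero.2 h2
  have e3 := sub_eq_zero.2 h3
  have : (2 : ℂ) • (ContinuousLinearMap.adjoint (creation h) (creation k ξ)
      - (inner ℂ h k : ℂ) • ξ) = 0 := by
    have e4 := congrArg (fun v => (-Complex.I) • v) e3
    simp only [smul_zero] at e4
    have e5 := congrArg₂ (· + ·) e2 e4
    simp only [add_zero] at e5
    rw [← e5]
    match_scalars <;> (ring_nf; simp only [Complex.I_sq]; ring)
  exact sub_eq_zero.1 ((smul_eq_zero.1 this).resolve_left two_ne_zero)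

lemma inner_vacuum_creation (h : Lp ℂ 2 leb) (ξ : Fock) :
    inner ℂ vacuum (creation h ξ) = 0 := by
  unfold vacuum
  rw [L2.inner_indicatorConstLp_one]
  refine (setIntegral_congr_ae measurableSet_vacuumSet (g := fun _ => 0) ?_).trans (by simp)
  filter_upwards [coeFn_creation h ξ] with c hc h0
  rw [hc]
  obtain ⟨n, t⟩ := c
  obtain rfl : n = 0 := h0
  rfl

lemma adjoint_creation_vacuum (h : Lp ℂ 2 leb) :
    ContinuousLinearMap.adjoint (creation h) vacuum = 0 := by
  refine ext_inner_right ℂ fun ξ => ?_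
  rw [ContinuousLinearMap.adjoint_inner_left, inner_vacuum_creation, inner_zero_left]

lemma toComplex_add (h k : RealL2) : toComplex (h + k) = toComplex h + toComplex k :=
  map_add (Complex.ofRealCLM.compLpL 2 leb) h k

lemma toComplex_smul (c : ℝ) (h : RealL2) : toComplex (c • h) = (c : ℂ) • toComplex h := by
  refine Lp.ext (.trans ?_ (Lp.coeFn_smul (c : ℂ) (toComplex h)).symm)
  refine (Complex.ofRealCLM.coeFn_compLp' (c • h)).trans ?_
  filter_upwards [Lp.coeFn_smul c h, Complex.ofRealCLM.coeFn_compLp h] with s h1 h2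
  change _ = (c : ℂ) • (Complex.ofRealCLM.compLp h) s
  rw [h1, h2]
  simp

lemma inner_toComplex (h k : RealL2) :
    (inner ℂ (toComplex h) (toComplex k) : ℂ) = ((inner ℝ h k : ℝ) : ℂ) := by
  simp only [L2.inner_def]
  refine .trans (integral_congr_ae ?_) (integral_ofReal (𝕜 := ℂ))
  filter_upwards [Complex.ofRealCLM.coeFn_compLp h, Complex.ofRealCLM.coeFn_compLp k] with s h1 h2
  unfold toComplex
  rw [h1, h2]
  simp

lemma norm_toComplex (h : RealL2) : ‖toComplex h‖ = ‖h‖ := by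
  have := inner_toComplex h h
  rw [inner_self_eq_norm_sq_to_K, real_inner_self_eq_norm_sq] at this
  exact (sq_eq_sq₀ (norm_nonneg _) (norm_nonneg _)).1 (Complex.ofReal_injective (by push_cast; exact this.trans (by push_cast; rfl)))

/-- The creation operator `l(h)` of a real function. -/
def cre (h : RealL2) : Fock →L[ℂ] Fock := creation (toComplex h)

/-- The annihilation operator `l(h)*` of a real function. -/
def ann (h : RealL2) : Fock →L[ℂ] Fock := ContinuousLinearMap.adjoint (creation (toComplex h))

lemma semicircular_eq (h : RealL2) : semicircular h = cre h + ann h := rfl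

lemma adjoint_cre (h : RealL2) : ContinuousLinearMap.adjoint (cre h) = ann h := rfl

lemma adjoint_ann (h : RealL2) : ContinuousLinearMap.adjoint (ann h) = cre h :=
  ContinuousLinearMap.adjoint_adjoint _

lemma inner_ann_left (h : RealL2) (ξ η : Fock) : inner ℂ (ann h ξ) η = inner ℂ ξ (cre h η) :=
  ContinuousLinearMap.adjoint_inner_left _ _ _

lemma inner_cre_left (h : RealL2) (ξ η : Fock) : inner ℂ (cre h ξ) η = inner ℂ ξ (ann h η) :=
  (ContinuousLinearMap.adjoint_inner_right _ _ _).symm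

lemma ann_cre (h k : RealL2) (ξ : Fock) : ann h (cre k ξ) = ((inner ℝ h k : ℝ) : ℂ) • ξ := by
  rw [← inner_toComplex]
  exact adjoint_creation_creation _ _ _

lemma ann_vacuum (h : RealL2) : ann h vacuum = 0 := adjoint_creation_vacuum _

lemma norm_cre_apply (h : RealL2) (ξ : Fock) : ‖cre h ξ‖ = ‖h‖ * ‖ξ‖ := by
  rw [cre, norm_creation_apply, norm_toComplex]

/-- `h ↦ l(h)` as a continuous real-linear map. -/
def creL : RealL2 →L[ℝ] (Fock →L[ℂ] Fock) :=
  LinearMap.mkContinuous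
    { toFun := cre
      map_add' := fun h k => by rw [cre, toComplex_add, creation_add]; rfl
      map_smul' := fun c h => by
        rw [cre, toComplex_smul, creation_smul]
        ext1 ξ
        exact (RCLike.real_smul_eq_coe_smul (K := ℂ) c (cre h ξ)).symm }
    1 fun h => by
      rw [one_mul]
      exact ContinuousLinearMap.opNorm_le_bound _ (norm_nonneg h) fun ξ => (norm_cre_apply h ξ).le

lemma continuous_cre : Continuous cre := creL.continuous

lemma continuous_ann : Continuous ann :=
  (ContinuousLinearMap.adjoint (𝕜 := ℂ) (E := Fock) (F := Fock)).continuous.comp continuous_cre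

lemma continuous_semicircular : Continuous semicircular := continuous_cre.add continuous_ann

lemma semicircular_add (h k : RealL2) :
    semicircular (h + k) = semicircular h + semicircular k := by
  simp only [semicircular, toComplex_add, creation_add, map_add]
  abel

lemma semicircular_smul (c : ℝ) (h : RealL2) :
    semicircular (c • h) = (c : ℂ) • semicircular h := by
  simp only [semicircular, toComplex_smul, creation_smul, map_smulₛₗ, smul_add]
  simp

/-! ### Elementary tensors in the Fock space -/

/-- The elementary tensor `h₁ ⊗ ⋯ ⊗ hₙ` in the Fock space. -/
def tens : List RealL2 → Fock
  | [] => vacuum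
  | h :: w => cre h (tens w)

@[simp] lemma tens_nil : tens [] = vacuum := rfl

@[simp] lemma tens_cons (h : RealL2) (w : List RealL2) : tens (h :: w) = cre h (tens w) := rfl

lemma inner_vacuum_self : (inner ℂ vacuum vacuum : ℂ) = 1 := by
  rw [inner_self_eq_norm_sq_to_K, norm_vacuum]; simp

/-- The scalar product `∏ ⟨vᵢ, wᵢ⟩` of two elementary tensors. -/
def wordInner : List RealL2 → List RealL2 → ℂ
  | [], [] => 1
  | h :: v, k :: w => ((inner ℝ h k : ℝ) : ℂ) * wordInner v w
  | _, _ => 0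

lemma inner_tens : ∀ v w : List RealL2, inner ℂ (tens v) (tens w) = wordInner v w
  | [], [] => inner_vacuum_self
  | [], k :: w => inner_vacuum_creation _ _
  | h :: v, [] => by
    rw [tens_cons, inner_cre_left, tens_nil, ann_vacuum, inner_zero_right]; rfl
  | h :: v, k :: w => by
    rw [tens_cons, inner_cre_left, tens_cons, ann_cre, inner_smul_right, inner_tens v w]; rfl

lemma wordInner_of_length_ne : ∀ {v w : List RealL2}, v.length ≠ w.length → wordInner v w = 0
  | [], [], h => absurd rfl h
  | [], _ :: _, _ => rfl
  | _ :: _, [], _ => rfl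
  | h :: v, k :: w, e => by
    have e' : v.length ≠ w.length := by simpa using e
    rw [wordInner, wordInner_of_length_ne e', mul_zero]

lemma wordInner_append : ∀ {v v' w w' : List RealL2}, v.length = v'.length →
    wordInner (v ++ w) (v' ++ w') = wordInner v v' * wordInner w w'
  | [], [], w, w', _ => by simp [wordInner]
  | h :: v, k :: v', w, w', e => by
    have e' : v.length = v'.length := by simpa using e
    simp [wordInner, wordInner_append e', mul_assoc]

lemma ann_tens_cons (h k : RealL2) (w : List RealL2) :
    ann h (tens (k :: w)) = ((inner ℝ h k : ℝ) : ℂ) • tens w := ann_cre _ _ _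

/-! ### Totality of the elementary tensors -/

/-- A π-λ argument on boxes. Square integrability gives integrability only on sets of finite
measure, so it is run inside a fixed finite box `D`, and the space is then exhausted by cubes. -/
lemma integral_pi_eq_zero {n : ℕ} {f : (Fin n → ℝ) → ℂ} (hf : MemLp f 2 (lebPow n))
    (h0 : ∀ E : Fin n → Set ℝ, (∀ i, MeasurableSet (E i)) → (∀ i, leb (E i) ≠ ∞) →
      ∫ t in Set.univ.pi E, f t ∂(lebPow n) = 0) :
    f =ᵐ[lebPow n] 0 := by
  have hint : ∀ s, lebPow n s < ∞ → IntegrableOn f s (lebPow n) := fun s hs => by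
    have : Fact (lebPow n s < ∞) := ⟨hs⟩
    exact (hf.restrict s).integrable (by norm_num)
  have key : ∀ D : Fin n → Set ℝ, (∀ i, MeasurableSet (D i)) → (∀ i, leb (D i) < ∞) →
      ∀ s, MeasurableSet s → ∫ t in s ∩ Set.univ.pi D, f t ∂(lebPow n) = 0 := by
    intro D hD hDf s hs
    have hDm : MeasurableSet (Set.univ.pi D) := MeasurableSet.univ_pi hD
    have hDfin : lebPow n (Set.univ.pi D) < ∞ := by
      rw [Measure.pi_pi]
      exact ENNReal.prod_lt_top fun i _ => hDf i
    have hDi := hint _ hDfin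
    refine MeasurableSpace.induction_on_inter
      (C := fun s _ => ∫ t in s ∩ Set.univ.pi D, f t ∂(lebPow n) = 0)
      generateFrom_pi.symm isPiSystem_pi ?_ ?_ ?_ ?_ s hs
    · simp
    · intro t ht
      obtain ⟨E, hE, rfl⟩ := ht
      have hEm : ∀ i, MeasurableSet (E i) := fun i => hE i (Set.mem_univ i)
      rw [← Set.pi_inter_distrib]
      refine h0 _ (fun i => MeasurableSet.inter (hEm i) (hD i)) fun i => ?_
      exact ((measure_mono Set.inter_subset_right).trans_lt (hDf i)).ne
    · intro t ht ih
      have h1 := integral_inter_add_sdiff ht hDi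
      rw [Set.inter_comm, ih, zero_add, Set.sdiff_eq, Set.inter_comm] at h1
      rw [h1]
      exact h0 D hD fun i => (hDf i).ne
    · intro g hg hgm ih
      rw [Set.iUnion_inter, integral_iUnion (fun i => (hgm i).inter hDm) ?_ ?_]
      · simp [ih]
      · exact fun i j hij => (hg hij).mono Set.inter_subset_left Set.inter_subset_left
      · exact hDi.mono_set (Set.iUnion_subset fun i => Set.inter_subset_right)
  have hz : ∀ k : ℕ, f =ᵐ[(lebPow n).restrict (Set.univ.pi fun _ => spanningSets leb k)] 0 := by
    intro k
    have hk := key (fun _ => spanningSets leb k) (fun _ => measurableSet_spanningSets _ _)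
      (fun _ => measure_spanningSets_lt_top _ _)
    refine ae_eq_zero_of_forall_setIntegral_eq_of_sigmaFinite (fun s hs _ => ?_) fun s hs _ => ?_
    · refine (hint _ ?_ : IntegrableOn f (Set.univ.pi fun _ => spanningSets leb k)
        (lebPow n)).integrableOn
      rw [Measure.pi_pi]
      exact ENNReal.prod_lt_top fun i _ => measure_spanningSets_lt_top _ _
    · rw [Measure.restrict_restrict hs]
      exact hk s hs
  have hU : (⋃ k : ℕ, Set.univ.pi fun _ : Fin n => spanningSets leb k) = Set.univ := by
    rw [Set.iUnion_univ_pi_of_monotone fun _ => monotone_spanningSets leb]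
    simp [iUnion_spanningSets]
  rw [← Measure.restrict_univ (μ := lebPow n), ← hU]
  exact (ae_restrict_iUnion_iff _ _).2 hz

lemma measurableSet_piece_pi {n : ℕ} {E : Fin n → Set ℝ} (hE : ∀ i, MeasurableSet (E i)) :
    MeasurableSet (piece n '' Set.univ.pi E) :=
  (measurableEmbedding_piece n).measurableSet_image.2 (MeasurableSet.univ_pi hE)

lemma confMeasure_piece_pi {n : ℕ} {E : Fin n → Set ℝ} (hE : ∀ i, leb (E i) ≠ ∞) :
    confMeasure (piece n '' Set.univ.pi E) ≠ ∞ := by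
  rw [confMeasure_piece, Measure.pi_pi]
  exact ENNReal.prod_ne_top fun i _ => hE i

/-- This turns orthogonality to all elementary tensors into the vanishing of all integrals over
boxes. -/
lemma tens_indicator : ∀ (n : ℕ) (E : Fin n → Set ℝ) (hE : ∀ i, MeasurableSet (E i))
    (hf : ∀ i, leb (E i) ≠ ∞),
    tens (List.ofFn fun i => indicatorConstLp 2 (hE i) (hf i) (1 : ℝ))
      = indicatorConstLp 2 (measurableSet_piece_pi hE) (confMeasure_piece_pi hf) (1 : ℂ)
  | 0, E, hE, hf => by
    simp only [List.ofFn_zero, tens_nil, vacuum]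
    congr 1
    rw [vacuumSet_eq]
    congr 1
    ext; simp
  | n + 1, E, hE, hf => by
    rw [List.ofFn_succ, tens_cons, tens_indicator n (fun i => E i.succ) (fun i => hE i.succ)
      (fun i => hf i.succ)]
    refine Lp.ext ((coeFn_creation _ _).trans (.trans ?_ indicatorConstLp_coeFn.symm))
    have h1 : (toComplex (indicatorConstLp 2 (hE 0) (hf 0) (1 : ℝ)) : ℝ → ℂ)
        =ᵐ[leb] (E 0).indicator fun _ => (1 : ℂ) := by
      refine (Complex.ofRealCLM.coeFn_compLp' _).trans ?_
      filter_upwards [indicatorConstLp_coeFn (hs := hE 0) (hμs := hf 0) (p := 2) (c := (1 : ℝ))]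
        with s hs
      rw [hs]
      by_cases h : s ∈ E 0 <;> simp [h]
    refine (creationFun_congr_left h1 _).trans ((creationFun_congr _
      indicatorConstLp_coeFn).trans (Filter.Eventually.of_forall ?_))
    rintro ⟨_ | m, t⟩
    · have : (⟨0, t⟩ : Conf) ∉ piece (n + 1) '' Set.univ.pi E := by
        rintro ⟨u, -, hu⟩
        exact absurd (congrArg Sigma.fst hu) (Nat.succ_ne_zero n)
      rw [Set.indicator_of_notMem this]
      rfl
    · have hiff : (⟨m + 1, t⟩ : Conf) ∈ piece (n + 1) '' Set.univ.pi E ↔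
          t 0 ∈ E 0 ∧ (⟨m, Fin.tail t⟩ : Conf) ∈ piece n '' Set.univ.pi fun i => E i.succ := by
        by_cases hmn : m = n
        · subst hmn
          change piece (m + 1) t ∈ _ ↔ _ ∧ piece m (Fin.tail t) ∈ _
          rw [(piece_injective _).mem_set_image, (piece_injective _).mem_set_image]
          simp [Set.mem_pi, Fin.forall_fin_succ, Fin.tail]
        · constructor
          · rintro ⟨u, -, hu⟩
            exact absurd (Nat.succ_injective (congrArg Sigma.fst hu)).symm hmn
          · rintro ⟨-, u, -, hu⟩
            exact absurd (congrArg Sigma.fst hu).symm hmn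
      change (E 0).indicator _ (t 0) * Set.indicator _ _ (⟨m, Fin.tail t⟩ : Conf) = _
      by_cases ha : t 0 ∈ E 0 <;>
      by_cases hb : (⟨m, Fin.tail t⟩ : Conf) ∈ piece n '' Set.univ.pi fun i => E i.succ <;>
      simp [Set.indicator, hiff, ha, hb]

/-- The elementary tensors are total in the Fock space. -/
lemma eq_zero_of_inner_tens {ξ : Fock} (h : ∀ w, inner ℂ (tens w) ξ = 0) : ξ = 0 := by
  refine Lp.ext (.trans (ae_conf.2 fun n => ?_) (Lp.coeFn_zero _ _ _).symm)
  refine integral_pi_eq_zero (f := fun t => ξ (piece n t)) ?_ fun E hE hf => ?_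
  · have h1 : MemLp ξ 2 ((lebPow n).map (piece n)) :=
      (Lp.memLp ξ).mono_measure (Measure.le_sum (fun n => (lebPow n).map (piece n)) n)
    exact (measurableEmbedding_piece n).memLp_map_measure_iff.1 h1
  · have h1 := h (List.ofFn fun i => indicatorConstLp 2 (hE i) (hf i) (1 : ℝ))
    rw [tens_indicator, L2.inner_indicatorConstLp_one] at h1
    rw [← h1]
    have hm : confMeasure.restrict (piece n '' Set.univ.pi E)
        = ((lebPow n).restrict (Set.univ.pi E)).map (piece n) := by
      ext s hs
      rw [Measure.restrict_apply hs, Measure.map_apply (measurable_piece n) hs,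
        Measure.restrict_apply (measurable_piece n hs), ← confMeasure_piece,
        Set.image_preimage_inter]
    rw [hm, (measurableEmbedding_piece n).integral_map]

/-- `h ↦ S(h)` as a continuous real-linear map. -/
def semicircularL : RealL2 →L[ℝ] (Fock →L[ℂ] Fock) where
  toFun := semicircular
  map_add' := semicircular_add
  map_smul' c h := by
    rw [semicircular_smul]
    ext1 ξ
    exact (RCLike.real_smul_eq_coe_smul (K := ℂ) c (semicircular h ξ)).symm
  cont := continuous_semicircular

/-! ### The Hilbert basis of elementary tensors -/

section Basis

variable {ι : Type} (e : HilbertBasis ι ℝ RealL2)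

/-- The elementary tensor `e_{i₁} ⊗ ⋯ ⊗ e_{iₙ}`. -/
def bvec (w : List ι) : Fock := tens (w.map e)

lemma bvec_cons (i : ι) (w : List ι) : bvec e (i :: w) = cre (e i) (bvec e w) := rfl

lemma eq_zero_of_apply_basis {F : Type*} [NormedAddCommGroup F] [NormedSpace ℝ F]
    {φ : RealL2 →L[ℝ] F} (h : ∀ i, φ (e i) = 0) : φ = 0 := by
  refine ContinuousLinearMap.ext_on (s := Set.range e) ?_ ?_
  · rw [Submodule.dense_iff_topologicalClosure_eq_top]
    exact e.dense_span
  · rintro _ ⟨i, rfl⟩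
    simpa using h i

open Classical in
lemma inner_basis (i j : ι) : (inner ℝ (e i) (e j) : ℝ) = if i = j then 1 else 0 :=
  orthonormal_iff_ite.1 e.orthonormal i j

open Classical in
lemma wordInner_map : ∀ v w : List ι, wordInner (v.map e) (w.map e) = if v = w then 1 else 0
  | [], [] => by simp [wordInner]
  | [], _ :: _ => by simp [wordInner]
  | _ :: _, [] => by simp [wordInner]
  | i :: v, j :: w => by
    simp only [List.map_cons, wordInner, wordInner_map v w, inner_basis, List.cons.injEq]
    by_cases h : i = j <;> by_cases h' : v = w <;> simp [h, h']

open Classical in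
lemma inner_bvec (v w : List ι) :
    inner ℂ (bvec e v) (bvec e w) = if v = w then (1 : ℂ) else 0 := by
  rw [bvec, bvec, inner_tens, wordInner_map]

lemma orthonormal_bvec : Orthonormal ℂ (bvec e) := by
  classical
  exact orthonormal_iff_ite.2 (inner_bvec e)

/-- Arbitrary letters are traded for basis letters one at a time: the first letter moves to the
right as an annihilation operator, and `ann k ξ` inherits the hypothesis because the pairing is
linear and continuous in `k` and vanishes for each `k = e i`. -/
lemma inner_tens_eq_zero : ∀ (w : List RealL2) (ξ : Fock), (∀ v, inner ℂ (bvec e v) ξ = 0) →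
    inner ℂ (tens w) ξ = 0
  | [], ξ, h => h []
  | k :: w, ξ, h => by
    rw [tens_cons, inner_cre_left]
    refine inner_tens_eq_zero w _ fun v => ?_
    rw [← inner_cre_left, ← inner_conj_symm]
    have h0 := eq_zero_of_apply_basis e (φ := ((innerSL ℂ ξ ∘L
      ContinuousLinearMap.apply ℂ Fock (bvec e v)).restrictScalars ℝ) ∘L creL) fun i => by
        change inner ℂ ξ (bvec e (i :: v)) = 0
        rw [← inner_conj_symm, h, map_zero]
    rw [show (inner ℂ ξ (cre k (bvec e v)) : ℂ) = 0 from
      congrArg (fun φ : RealL2 →L[ℝ] ℂ => φ k) h0, map_zero]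

lemma span_bvec_orthogonal : (Submodule.span ℂ (Set.range (bvec e)))ᗮ = ⊥ := by
  rw [eq_bot_iff]
  intro ξ hξ
  rw [Submodule.mem_orthogonal] at hξ
  exact (Submodule.mem_bot ℂ).2 (eq_zero_of_inner_tens fun w => inner_tens_eq_zero e w ξ
    fun v => hξ _ (Submodule.subset_span ⟨v, rfl⟩))

/-- The Hilbert basis of the Fock space given by the elementary tensors `e_{i₁} ⊗ ⋯ ⊗ e_{iₙ}`. -/
def fockBasis : HilbertBasis (List ι) ℂ Fock :=
  HilbertBasis.mkOfOrthogonalEqBot (orthonormal_bvec e) (span_bvec_orthogonal e)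

@[simp] lemma coe_fockBasis : ⇑(fockBasis e) = bvec e :=
  HilbertBasis.coe_mkOfOrthogonalEqBot _ _

/-- A vector with no coefficients outside `S` lies in the closed span of `S`. -/
lemma mem_closure_span_bvec {S : Set (List ι)} {ξ : Fock}
    (h : ∀ w ∉ S, inner ℂ (bvec e w) ξ = 0) :
    ξ ∈ (Submodule.span ℂ (bvec e '' S)).topologicalClosure := by
  have hs := (fockBasis e).hasSum_repr ξ
  simp only [HilbertBasis.repr_apply_apply, coe_fockBasis] at hs
  refine (Submodule.isClosed_topologicalClosure _).mem_of_tendsto hs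
    (Filter.Eventually.of_forall fun s => ?_)
  refine Submodule.sum_mem _ fun w _ => ?_
  by_cases hw : w ∈ S
  · exact Submodule.smul_mem _ _ (Submodule.le_topologicalClosure _
      (Submodule.subset_span ⟨w, hw, rfl⟩))
  · rw [h w hw, zero_smul]
    exact Submodule.zero_mem _

lemma ext_bvec {F : Type*} [NormedAddCommGroup F] [NormedSpace ℂ F] {φ ψ : Fock →L[ℂ] F}
    (h : ∀ w, φ (bvec e w) = ψ (bvec e w)) : φ = ψ := by
  refine ContinuousLinearMap.ext_on (s := Set.range (bvec e)) ?_ ?_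
  · rw [Submodule.dense_iff_topologicalClosure_eq_top, ← coe_fockBasis]
    exact (fockBasis e).dense_span
  · rintro _ ⟨i, rfl⟩
    exact h i

lemma norm_sq_linearCombination {κ : Type*} {b : κ → Fock} (hb : Orthonormal ℂ b) (c : κ →₀ ℂ) :
    ‖Finsupp.linearCombination ℂ b c‖ ^ 2 = ∑ i ∈ c.support, ‖c i‖ ^ 2 := by
  have h := hb.inner_finsupp_eq_sum_left c c
  rw [inner_self_eq_norm_sq_to_K] at h
  refine Complex.ofReal_injective ?_
  push_cast
  refine h.trans (Finset.sum_congr rfl fun i _ => ?_)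
  beta_reduce
  rw [← Complex.normSq_eq_conj_mul_self, Complex.normSq_eq_norm_sq]
  push_cast
  rfl

section Extension

variable {F : Type*} [NormedAddCommGroup F] [NormedSpace ℂ F] [CompleteSpace F]

/-- The continuous linear map with prescribed values on the basis of elementary tensors
(provided that there is one). -/
def basisExt (q : List ι → F) : Fock →L[ℂ] F :=
  (Finsupp.linearCombination ℂ q).extendOfNorm (Finsupp.linearCombination ℂ (bvec e))

lemma basisExt_bvec {q : List ι → F} {C : ℝ} (hC : ∀ c : List ι →₀ ℂ,
    ‖Finsupp.linearCombination ℂ q c‖ ≤ C * ‖Finsupp.linearCombination ℂ (bvec e) c‖)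
    (w : List ι) : basisExt e q (bvec e w) = q w := by
  have hd : DenseRange (Finsupp.linearCombination ℂ (bvec e)) := by
    have := (fockBasis e).dense_span
    rw [coe_fockBasis, ← Submodule.dense_iff_topologicalClosure_eq_top,
      ← Finsupp.range_linearCombination] at this
    exact this
  have := LinearMap.extendOfNorm_eq (f := Finsupp.linearCombination ℂ q) hd ⟨C, hC⟩
    (Finsupp.single w 1)
  simpa [basisExt] using this

end Extension

/-! ### Right semicircular operators and the separating property of the vacuum -/

/-- The right creation operator `r(eᵢ)`. -/
def rcre (i : ι) : Fock →L[ℂ] Fock := basisExt e fun w => bvec e (w ++ [i])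

lemma rcre_bvec (i : ι) (w : List ι) : rcre e i (bvec e w) = bvec e (w ++ [i]) := by
  refine basisExt_bvec e (C := 1) (fun c => ?_) w
  rw [one_mul]
  refine le_of_eq ((sq_eq_sq₀ (norm_nonneg _) (norm_nonneg _)).1 ?_)
  rw [norm_sq_linearCombination (orthonormal_bvec e), norm_sq_linearCombination]
  exact (orthonormal_bvec e).comp (fun w => w ++ [i]) (List.append_left_injective [i])

/-- The right annihilation operator `r(eᵢ)*`. -/
def rann (i : ι) : Fock →L[ℂ] Fock := ContinuousLinearMap.adjoint (rcre e i)

lemma ext_inner_bvec {ξ η : Fock} (h : ∀ w, inner ℂ (bvec e w) ξ = inner ℂ (bvec e w) η) :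
    ξ = η :=
  (fockBasis e).repr.injective (by
    ext w
    simpa [HilbertBasis.repr_apply_apply] using h w)

lemma rann_nil (i : ι) : rann e i vacuum = 0 := by
  classical
  refine ext_inner_bvec e fun w => ?_
  rw [rann, ContinuousLinearMap.adjoint_inner_right, rcre_bvec]
  change inner ℂ _ (bvec e []) = _
  rw [inner_bvec]
  simp

open Classical in
lemma rann_append (i j : ι) (w : List ι) :
    rann e i (bvec e (w ++ [j])) = if i = j then bvec e w else 0 := by
  refine ext_inner_bvec e fun v => ?_
  rw [rann, ContinuousLinearMap.adjoint_inner_right, rcre_bvec, inner_bvec]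
  by_cases h : i = j <;> simp [h, inner_bvec]

open Classical in
lemma ann_bvec_cons (i j : ι) (w : List ι) :
    ann (e i) (bvec e (j :: w)) = if i = j then bvec e w else 0 := by
  rw [bvec_cons, ann_cre, inner_basis]
  split_ifs <;> simp

lemma ann_bvec_nil (i : ι) : ann (e i) (bvec e []) = 0 := ann_vacuum _

/-- The right semicircular operator of `eᵢ`. -/
def rsemi (i : ι) : Fock →L[ℂ] Fock := rcre e i + rann e i

/-- Left and right operators act on opposite ends of a word, so they can only interfere on the
vacuum. There the commutators of l(eⱼ)* with r(eᵢ) and of l(eⱼ) with r(eᵢ)* are δᵢⱼ and -δᵢⱼ, and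
only their sum vanishes (`h3`). -/
lemma semicircular_rsemi_basis (i j : ι) :
    semicircular (e j) * rsemi e i = rsemi e i * semicircular (e j) := by
  classical
  have h1 : cre (e j) * rcre e i = rcre e i * cre (e j) := by
    refine ext_bvec e fun w => ?_
    simp only [mul_apply_eq_comp, rcre_bvec, ← bvec_cons, List.cons_append]
  have h2 : ann (e j) * rann e i = rann e i * ann (e j) := by
    have := congrArg star h1
    simp only [star_mul] at this
    exact this.symm
  have h3 : ann (e j) * rcre e i + cre (e j) * rann e i
      = rcre e i * ann (e j) + rann e i * cre (e j) := by
    refine ext_bvec e fun w => ?_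
    simp only [add_apply, mul_apply_eq_comp, rcre_bvec]
    cases w with
    | nil =>
      rw [ann_bvec_nil, map_zero, List.nil_append, ann_bvec_cons, ← bvec_cons,
        show rann e i (bvec e []) = 0 from rann_nil e i, map_zero,
        show bvec e [j] = bvec e ([] ++ [j]) from rfl, rann_append]
      simp [eq_comm]
    | cons k v =>
      have hA : ann (e j) (bvec e ((k :: v) ++ [i])) = rcre e i (ann (e j) (bvec e (k :: v))) := by
        rw [List.cons_append, ann_bvec_cons, ann_bvec_cons]
        split_ifs
        · rw [rcre_bvec]
        · rw [map_zero]
      have hB : cre (e j) (rann e i (bvec e (k :: v))) = rann e i (cre (e j) (bvec e (k :: v))) := by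
        obtain ⟨u, l, hu⟩ := List.eq_nil_or_concat (k :: v) |>.resolve_left (List.cons_ne_nil _ _)
        rw [hu, List.concat_eq_append, ← bvec_cons, ← List.cons_append, rann_append, rann_append]
        split_ifs
        · rw [bvec_cons]
        · rw [map_zero]
      rw [hA, hB]
  simp only [semicircular_eq, rsemi, add_mul, mul_add]
  rw [h1, h2]
  rw [← sub_eq_zero] at h3 ⊢
  rw [← h3]
  abel

lemma semicircular_rsemi (h : RealL2) (i : ι) :
    semicircular h * rsemi e i = rsemi e i * semicircular h := by
  have := eq_zero_of_apply_basis e (φ := (ContinuousLinearMap.mul ℝ (Fock →L[ℂ] Fock)).flip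
      (rsemi e i) ∘L semicircularL - ContinuousLinearMap.mul ℝ (Fock →L[ℂ] Fock)
      (rsemi e i) ∘L semicircularL) fun j => by
    change semicircular (e j) * rsemi e i - rsemi e i * semicircular (e j) = 0
    rw [semicircular_rsemi_basis, sub_self]
  exact sub_eq_zero.1 (congrArg (fun φ : RealL2 →L[ℝ] (Fock →L[ℂ] Fock) => φ h) this)

lemma star_semicircular (h : RealL2) : star (semicircular h) = semicircular h := by
  rw [semicircular_eq, star_add, add_comm]
  change ContinuousLinearMap.adjoint (ann h) + ContinuousLinearMap.adjoint (cre h) = _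
  rw [adjoint_ann, adjoint_cre]

lemma mem_SC_iff {X : Fock →L[ℂ] Fock} : X ∈ SC ↔
    ∀ Y ∈ StarSubalgebra.centralizer ℂ (Set.range semicircular), Y * X = X * Y := by
  change X ∈ StarSubalgebra.centralizer ℂ _ ↔ _
  rw [StarSubalgebra.mem_centralizer_iff]
  refine ⟨fun h Y hY => (h Y hY).1, fun h Y hY => ⟨h Y hY, h _ (star_mem hY)⟩⟩

lemma mem_centralizer_semicircular {Y : Fock →L[ℂ] Fock} :
    Y ∈ StarSubalgebra.centralizer ℂ (Set.range semicircular) ↔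
      ∀ h, semicircular h * Y = Y * semicircular h := by
  rw [StarSubalgebra.mem_centralizer_iff]
  constructor
  · exact fun h k => (h _ ⟨k, rfl⟩).1
  · rintro h _ ⟨k, rfl⟩
    rw [star_semicircular]
    exact ⟨h k, h k⟩

lemma semicircular_mem_SC (h : RealL2) : semicircular h ∈ SC :=
  mem_SC_iff.2 fun _ hY => (mem_centralizer_semicircular.1 hY h).symm

lemma rsemi_commute {X : Fock →L[ℂ] Fock} (hX : X ∈ SC) (i : ι) :
    rsemi e i * X = X * rsemi e i :=
  mem_SC_iff.1 hX _ (mem_centralizer_semicircular.2 fun h => semicircular_rsemi e h i)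

include e in
/-- The vacuum vector is separating for `𝒮𝒞`. -/
lemma eq_zero_of_apply_vacuum {X : Fock →L[ℂ] Fock} (hX : X ∈ SC) (h0 : X vacuum = 0) : X = 0 := by
  have key : ∀ n, ∀ w : List ι, w.length = n → X (bvec e w) = 0 := by
    classical
    intro n
    induction n using Nat.strong_induction_on with
    | _ n ih =>
      intro w hw
      rcases List.eq_nil_or_concat w with rfl | ⟨u, i, rfl⟩
      · exact h0
      · rw [List.concat_eq_append] at hw ⊢
        simp only [List.length_append, List.length_singleton] at hw
        -- The tensor of `u ++ [i]` is the right semicircular operator applied to that of `u`, minus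
        -- a shorter word. `X` commutes with that operator and kills all shorter words.
        have h1 := congrArg (fun Y : Fock →L[ℂ] Fock => Y (bvec e u)) (rsemi_commute e hX i)
        simp only [mul_apply_eq_comp, rsemi, add_apply, rcre_bvec, map_add,
          ih u.length (by omega) u rfl, map_zero] at h1
        have h2 : X (rann e i (bvec e u)) = 0 := by
          rcases List.eq_nil_or_concat u with rfl | ⟨u', j, rfl⟩
          · rw [show rann e i (bvec e []) = 0 from rann_nil e i, map_zero]
          · rw [List.concat_eq_append] at hw ⊢
            simp only [List.length_append, List.length_singleton] at hw
            rw [rann_append]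
            split_ifs
            · exact ih u'.length (by omega) u' rfl
            · exact map_zero X
        rw [h2, add_zero] at h1
        exact h1.symm
  exact ext_bvec e fun w => by rw [key _ w rfl]; rfl

end Basis

/-! ### Wick products and the Haagerup inequality -/

/-- `l(h₁) ⋯ l(hₙ)`. -/
def creWord (w : List RealL2) : Fock →L[ℂ] Fock := (w.map cre).prod

/-- `l(h₁)* ⋯ l(hₙ)*`. -/
def annWord (w : List RealL2) : Fock →L[ℂ] Fock := (w.map ann).prod

@[simp] lemma creWord_nil : creWord [] = 1 := rfl

@[simp] lemma annWord_nil : annWord [] = 1 := rfl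

@[simp] lemma creWord_cons (h : RealL2) (w : List RealL2) :
    creWord (h :: w) = cre h * creWord w := by simp [creWord]

@[simp] lemma annWord_cons (h : RealL2) (w : List RealL2) :
    annWord (h :: w) = ann h * annWord w := by simp [annWord]

lemma annWord_append (v w : List RealL2) : annWord (v ++ w) = annWord v * annWord w := by
  simp [annWord]

lemma inner_creWord_left : ∀ (w : List RealL2) (ξ η : Fock),
    inner ℂ (creWord w ξ) η = inner ℂ ξ (annWord w.reverse η)
  | [], ξ, η => rfl
  | h :: w, ξ, η => by
    rw [creWord_cons, mul_apply_eq_comp, inner_cre_left, inner_creWord_left w, List.reverse_cons,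
      annWord_append, mul_apply_eq_comp, annWord_cons, annWord_nil, mul_one]

lemma inner_creWord_creWord : ∀ {v w : List RealL2} (ξ η : Fock), v.length = w.length →
    inner ℂ (creWord v ξ) (creWord w η) = wordInner v w * inner ℂ ξ η
  | [], [], ξ, η, _ => by simp [wordInner]
  | h :: v, k :: w, ξ, η, e => by
    rw [creWord_cons, creWord_cons, mul_apply_eq_comp, mul_apply_eq_comp, inner_cre_left, ann_cre,
      inner_smul_right, inner_creWord_creWord ξ η (by simpa using e), wordInner, mul_assoc]

/-- The Wick product of `h₁, …, hₙ`, the element of `𝒮𝒞` whose value on the vacuum is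
`h₁ ⊗ ⋯ ⊗ hₙ`. -/
def wick : List RealL2 → (Fock →L[ℂ] Fock)
  | [] => 1
  | h :: w => annWord (h :: w) + cre h * wick w

/-- A Chebyshev recursion, with the contraction l(h)* l(k) = ⟨h, k⟩ as correction. It shows that
Wick products, defined by creation and annihilation operators that need not lie in 𝒮𝒞, are
polynomials in the S(h). -/
lemma wick_cons_cons (h k : RealL2) (w : List RealL2) :
    wick (h :: k :: w)
      = semicircular h * wick (k :: w) - ((inner ℝ h k : ℝ) : ℂ) • wick w := by
  ext1 ξ
  simp only [wick, semicircular_eq, add_mul, sub_apply, add_apply, mul_apply_eq_comp, smul_apply,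
    map_add, ann_cre, annWord_cons]
  abel

lemma wick_singleton (h : RealL2) : wick [h] = semicircular h := by
  simp [wick, semicircular_eq, add_comm]

lemma wick_mem_SC : ∀ w, wick w ∈ SC
  | [] => one_mem SC.toStarSubalgebra
  | [h] => by rw [wick_singleton]; exact semicircular_mem_SC h
  | h :: k :: w => by
    rw [wick_cons_cons]
    exact sub_mem (S := StarSubalgebra ℂ (Fock →L[ℂ] Fock)) (H := SC.toStarSubalgebra)
      (mul_mem (semicircular_mem_SC h) (wick_mem_SC (k :: w)))
      (SMulMemClass.smul_mem (s := SC.toStarSubalgebra) _ (wick_mem_SC w))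

lemma annWord_vacuum : ∀ {w : List RealL2}, w ≠ [] → annWord w vacuum = 0
  | [h], _ => by simp [ann_vacuum]
  | h :: k :: w, _ => by
    rw [annWord_cons, mul_apply_eq_comp, annWord_vacuum (List.cons_ne_nil k w), map_zero]

lemma wick_vacuum : ∀ w, wick w vacuum = tens w
  | [] => rfl
  | h :: w => by
    rw [wick, add_apply, annWord_vacuum (List.cons_ne_nil h w), mul_apply_eq_comp, wick_vacuum w,
      zero_add, tens_cons]

/-- The normally ordered expansion, one term per cut position; the Haagerup inequality is proved
term by term. -/
lemma wick_eq_sum : ∀ w : List RealL2,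
    wick w = ∑ k ∈ Finset.range (w.length + 1), creWord (w.take k) * annWord (w.drop k)
  | [] => by simp [wick]
  | h :: w => by
    rw [List.length_cons, Finset.sum_range_succ', wick, wick_eq_sum w, Finset.mul_sum, add_comm]
    simp [mul_assoc]

/-! ### The Haagerup inequality and the operator of a vector of bounded order. -/

section Basis

variable {ι : Type} (e : HilbertBasis ι ℝ RealL2)

lemma inner_creWord_basis [DecidableEq ι] {v w : List ι} (ξ η : Fock) (hl : v.length = w.length) :
    inner ℂ (creWord (v.map e) ξ) (creWord (w.map e) η) = if v = w then inner ℂ ξ η else 0 := by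
  rw [inner_creWord_creWord _ _ (by simpa using hl), wordInner_map]
  by_cases h : v = w <;> simp [h]

/-- For words of a common length the operators l(e_w) are isometries with pairwise orthogonal
ranges. -/
lemma norm_sq_sum_creWord {s : Finset (List ι)} {m : ℕ} (hs : ∀ w ∈ s, w.length = m)
    (ζ : List ι → Fock) :
    ‖∑ w ∈ s, creWord (w.map e) (ζ w)‖ ^ 2 = ∑ w ∈ s, ‖ζ w‖ ^ 2 := by
  classical
  refine Complex.ofReal_injective ?_
  push_cast
  have h := inner_self_eq_norm_sq_to_K (𝕜 := ℂ) (∑ w ∈ s, creWord (w.map e) (ζ w))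
  refine h.symm.trans ?_
  rw [sum_inner]
  refine Finset.sum_congr rfl fun v hv => ?_
  rw [inner_sum, Finset.sum_eq_single_of_mem v hv]
  · rw [inner_creWord_basis e _ _ rfl, if_pos rfl]
    exact inner_self_eq_norm_sq_to_K _
  · intro w hw hne
    rw [inner_creWord_basis e _ _ ((hs v hv).trans (hs w hw).symm), if_neg hne.symm]

/-- Bessel's inequality for these ranges: the vector `ζ` below is the projection of `η` on their
sum, so ⟨ζ, η⟩ = ‖ζ‖² and Cauchy–Schwarz gives ‖ζ‖ ≤ ‖η‖. Words are reversed because taking adjoints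
reverses products. -/
lemma sum_norm_sq_annWord_le {s : Finset (List ι)} {m : ℕ} (hs : ∀ w ∈ s, w.length = m)
    (η : Fock) : ∑ w ∈ s, ‖annWord (w.map e) η‖ ^ 2 ≤ ‖η‖ ^ 2 := by
  classical
  set t := s.image List.reverse
  have ht : ∀ w ∈ t, w.length = m := by
    intro w hw
    obtain ⟨v, hv, rfl⟩ := Finset.mem_image.1 hw
    rw [List.length_reverse, hs v hv]
  have h0 : ∑ w ∈ s, ‖annWord (w.map e) η‖ ^ 2
      = ∑ w ∈ t, ‖annWord (w.reverse.map e) η‖ ^ 2 := by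
    rw [Finset.sum_image fun _ _ _ _ h => List.reverse_injective h]
    simp
  have h1 := norm_sq_sum_creWord e ht fun w => annWord (w.reverse.map e) η
  set ζ := ∑ w ∈ t, creWord (w.map e) (annWord (w.reverse.map e) η)
  have h2 : inner ℂ ζ η = ((‖ζ‖ ^ 2 : ℝ) : ℂ) := by
    rw [h1, sum_inner]
    push_cast
    refine Finset.sum_congr rfl fun w _ => ?_
    rw [inner_creWord_left, ← List.map_reverse]
    exact inner_self_eq_norm_sq_to_K _
  have h3 : ‖ζ‖ ^ 2 ≤ ‖ζ‖ * ‖η‖ := by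
    have := norm_inner_le_norm (𝕜 := ℂ) ζ η
    rw [h2, Complex.norm_real, norm_pow, norm_norm] at this
    exact this
  rw [h0, ← h1]
  have h4 : ‖ζ‖ ≤ ‖η‖ := by
    rcases (norm_nonneg ζ).eq_or_lt with hz | hz
    · rw [← hz]; exact norm_nonneg _
    · rw [pow_two] at h3
      exact le_of_mul_le_mul_left h3 hz
  gcongr

/-- Words are grouped by their prefix of length `k`: different prefixes give orthogonal vectors, and
within one group Cauchy–Schwarz separates the coefficients from the annihilated vectors, to which
Bessel's inequality applies. -/
lemma norm_sum_creWord_annWord_le {s : Finset (List ι)} {m : ℕ} (hs : ∀ w ∈ s, w.length = m)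
    (k : ℕ) (c : List ι → ℂ) :
    ‖∑ w ∈ s, c w • (creWord ((w.take k).map e) * annWord ((w.drop k).map e))‖
      ≤ √(∑ w ∈ s, ‖c w‖ ^ 2) := by
  classical
  refine ContinuousLinearMap.opNorm_le_bound _ (Real.sqrt_nonneg _) fun η => ?_
  refine abs_le_of_sq_le_sq' ?_ (by positivity) |>.2
  rw [mul_pow, Real.sq_sqrt (Finset.sum_nonneg fun _ _ => by positivity)]
  set U := s.image (List.take k)
  have hU : ∀ u ∈ U, u.length = min k m := by
    intro u hu
    obtain ⟨v, hv, rfl⟩ := Finset.mem_image.1 hu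
    rw [List.length_take, hs v hv]
  have hfib : (∑ w ∈ s, c w • (creWord ((w.take k).map e) * annWord ((w.drop k).map e))) η
      = ∑ u ∈ U, creWord (u.map e)
        (∑ w ∈ s with w.take k = u, c w • annWord ((w.drop k).map e) η) := by
    rw [sum_apply, ← Finset.sum_fiberwise_of_maps_to (g := List.take k) (t := U)
      fun w hw => Finset.mem_image_of_mem _ hw]
    refine Finset.sum_congr rfl fun u _ => ?_
    rw [map_sum]
    refine Finset.sum_congr rfl fun w hw => ?_
    rw [(Finset.mem_filter.1 hw).2, smul_apply, mul_apply_eq_comp, map_smul]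
  rw [hfib, norm_sq_sum_creWord e hU, Finset.sum_mul, ← Finset.sum_fiberwise_of_maps_to
    (s := s) (g := List.take k) (t := U) fun w hw => Finset.mem_image_of_mem _ hw]
  refine Finset.sum_le_sum fun u _ => ?_
  rw [← Finset.sum_mul]
  set sf := s.filter fun w => w.take k = u
  have hB : ∑ w ∈ sf, ‖annWord ((w.drop k).map e) η‖ ^ 2 ≤ ‖η‖ ^ 2 := by
    -- Once the prefix is fixed, a word is determined by its suffix, so each suffix is counted once.
    have hinj : Set.InjOn (List.drop k) (sf : Set (List ι)) := by
      intro v hv w hw hvw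
      have h1 := (Finset.mem_filter.1 hv).2
      have h2 := (Finset.mem_filter.1 hw).2
      rw [← List.take_append_drop k v, ← List.take_append_drop k w, h1, h2, hvw]
    rw [← Finset.sum_image (f := fun v => ‖annWord (v.map e) η‖ ^ 2) hinj]
    refine sum_norm_sq_annWord_le e (m := m - k) (fun w hw => ?_) η
    obtain ⟨v, hv, rfl⟩ := Finset.mem_image.1 hw
    rw [List.length_drop, hs v (Finset.mem_filter.1 hv).1]
  calc ‖∑ w ∈ sf, c w • annWord ((w.drop k).map e) η‖ ^ 2
      ≤ (∑ w ∈ sf, ‖c w‖ * ‖annWord ((w.drop k).map e) η‖) ^ 2 := by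
        gcongr
        exact (norm_sum_le _ _).trans_eq (Finset.sum_congr rfl fun _ _ => norm_smul _ _)
    _ ≤ (∑ w ∈ sf, ‖c w‖ ^ 2) * ∑ w ∈ sf, ‖annWord ((w.drop k).map e) η‖ ^ 2 :=
        Finset.sum_mul_sq_le_sq_mul_sq _ _ _
    _ ≤ (∑ w ∈ sf, ‖c w‖ ^ 2) * ‖η‖ ^ 2 := by gcongr

open Classical in
/-- The values of `wickExt` on the basis. -/
def wickBasis (n : ℕ) (w : List ι) : Fock →L[ℂ] Fock :=
  if w.length ≤ n then wick (w.map e) else 0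

lemma wickBasis_eq_sum (n : ℕ) (w : List ι) :
    wickBasis e n w = ∑ m ∈ Finset.range (n + 1), ∑ k ∈ Finset.range (m + 1),
      if w.length = m then creWord ((w.take k).map e) * annWord ((w.drop k).map e) else 0 := by
  unfold wickBasis
  split_ifs with h
  · rw [Finset.sum_eq_single_of_mem w.length (Finset.mem_range.2 (by omega))]
    · simp [wick_eq_sum, List.map_take, List.map_drop]
    · intro m _ hm
      simp [hm.symm]
  · refine (Finset.sum_eq_zero fun m hm => Finset.sum_eq_zero fun k _ => ?_).symm
    rw [if_neg]
    rintro rfl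
    exact h (by simpa [Nat.lt_succ_iff] using hm)

/-- The Haagerup inequality. -/
lemma norm_wickBasis_le (n : ℕ) (c : List ι →₀ ℂ) :
    ‖Finsupp.linearCombination ℂ (wickBasis e n) c‖
      ≤ (∑ m ∈ Finset.range (n + 1), ∑ _k ∈ Finset.range (m + 1), (1 : ℝ))
        * ‖Finsupp.linearCombination ℂ (bvec e) c‖ := by
  classical
  -- The sum splits into blocks by length `m` and cut `k`; each block is bounded by the ℓ² norm of
  -- `c`, and the constant counts the blocks.
  have h0 : Finsupp.linearCombination ℂ (wickBasis e n) c
      = ∑ m ∈ Finset.range (n + 1), ∑ k ∈ Finset.range (m + 1),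
        ∑ w ∈ c.support with w.length = m,
          c w • (creWord ((w.take k).map e) * annWord ((w.drop k).map e)) := by
    rw [Finsupp.linearCombination_apply, Finsupp.sum]
    simp only [wickBasis_eq_sum, Finset.smul_sum, Finset.sum_filter]
    rw [Finset.sum_comm]
    refine Finset.sum_congr rfl fun m _ => ?_
    rw [Finset.sum_comm]
    refine Finset.sum_congr rfl fun k _ => Finset.sum_congr rfl fun w _ => ?_
    split_ifs <;> simp
  rw [h0, Finset.sum_mul]
  refine (norm_sum_le _ _).trans (Finset.sum_le_sum fun m _ => ?_)
  rw [Finset.sum_mul]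
  refine (norm_sum_le _ _).trans (Finset.sum_le_sum fun k _ => ?_)
  rw [one_mul]
  refine (norm_sum_creWord_annWord_le e (m := m)
    (fun w hw => (Finset.mem_filter.1 hw).2) k c).trans ?_
  rw [Real.sqrt_le_left (norm_nonneg _), norm_sq_linearCombination (orthonormal_bvec e)]
  exact Finset.sum_le_sum_of_subset_of_nonneg (Finset.filter_subset _ _)
    fun _ _ _ => by positivity

/-- The bounded linear map that sends `h₁ ⊗ ⋯ ⊗ hₘ` to its Wick product if `m ≤ n`, and
to `0` if `m > n`. -/
def wickExt (n : ℕ) : Fock →L[ℂ] (Fock →L[ℂ] Fock) := basisExt e (wickBasis e n)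

lemma wickExt_bvec (n : ℕ) (w : List ι) : wickExt e n (bvec e w) = wickBasis e n w :=
  basisExt_bvec e (norm_wickBasis_le e n) w

lemma isClosed_SC : IsClosed {X : Fock →L[ℂ] Fock | X ∈ SC} := by
  have : {X : Fock →L[ℂ] Fock | X ∈ SC} = Set.centralizer
      (StarSubalgebra.centralizer ℂ (Set.range semicircular) : Set (Fock →L[ℂ] Fock)) := by
    ext X
    exact mem_SC_iff
  rw [this]
  exact Set.isClosed_centralizer _

lemma wickExt_mem_SC (n : ℕ) (ξ : Fock) : wickExt e n ξ ∈ SC := by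
  have hd : ξ ∈ closure (Submodule.span ℂ (Set.range (bvec e)) : Set Fock) := by
    have := (fockBasis e).dense_span
    rw [coe_fockBasis, ← Submodule.dense_iff_topologicalClosure_eq_top] at this
    exact this ξ
  refine closure_minimal (t := {η | wickExt e n η ∈ SC}) (fun η hη => ?_)
    (isClosed_SC.preimage (wickExt e n).continuous) hd
  refine Submodule.span_induction (p := fun η _ => wickExt e n η ∈ SC) ?_ ?_ ?_ ?_ hη
  · rintro _ ⟨w, rfl⟩
    rw [wickExt_bvec, wickBasis]
    split_ifs
    · exact wick_mem_SC _
    · exact zero_mem SC.toStarSubalgebra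
  · rw [map_zero]
    exact zero_mem SC.toStarSubalgebra
  · intro x y _ _ hx hy
    rw [map_add]
    exact add_mem (S := StarSubalgebra ℂ (Fock →L[ℂ] Fock)) (s := SC.toStarSubalgebra) hx hy
  · intro a x _ hx
    rw [map_smul]
    exact SMulMemClass.smul_mem (s := SC.toStarSubalgebra) a hx

/-- Evaluation at the vacuum after `wickExt`: the orthogonal projection on the sum of the
particle spaces of order at most `n`. -/
def wickVac (n : ℕ) : Fock →L[ℂ] Fock :=
  ContinuousLinearMap.apply ℂ Fock vacuum ∘L wickExt e n

lemma wickVac_apply (n : ℕ) (ξ : Fock) : wickVac e n ξ = wickExt e n ξ vacuum := rfl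

open Classical in
lemma wickVac_bvec (n : ℕ) (w : List ι) :
    wickVac e n (bvec e w) = if w.length ≤ n then bvec e w else 0 := by
  rw [wickVac_apply, wickExt_bvec, wickBasis]
  split_ifs
  · exact wick_vacuum _
  · rfl

lemma isBoundedElement_of_wickVac {n : ℕ} {ξ : Fock} (h : wickVac e n ξ = ξ) :
    IsBoundedElement ξ := ⟨_, wickExt_mem_SC e n ξ, h⟩

/-- `toOp` is a pointwise choice; the separating vacuum identifies it with a bounded linear map,
which gives measurability and integrability of operator-valued processes. -/
lemma toOp_eq_wickExt {n : ℕ} {ξ : Fock} (h : wickVac e n ξ = ξ) : toOp ξ = wickExt e n ξ := by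
  have hb := isBoundedElement_of_wickVac e h
  rw [toOp, dif_pos hb]
  obtain ⟨h1, h2⟩ := hb.choose_spec
  refine sub_eq_zero.1 (eq_zero_of_apply_vacuum e ?_ ?_)
  · exact sub_mem (S := StarSubalgebra ℂ (Fock →L[ℂ] Fock)) (H := SC.toStarSubalgebra) h1
      (wickExt_mem_SC e n ξ)
  · rw [sub_apply, h2, ← wickVac_apply, h, sub_self]

end Basis

/-! ### Elementary multiprocesses -/

lemma inner_elementary {p : ℕ} (h k : Fin p → RealL2) (x y : Fin (p + 1) → Fock) :
    inner ℂ (elementary h x) (elementary k y)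
      = (∏ i, ((inner ℝ (h i) (k i) : ℝ) : ℂ)) * ∏ j, inner ℂ (x j) (y j) := by
  have h1 : inner ℂ (pureTensor fun j => toComplex (h j)) (pureTensor fun j => toComplex (k j))
      = ∏ i, ((inner ℝ (h i) (k i) : ℝ) : ℂ) := by
    rw [inner_pureTensor]
    exact Finset.prod_congr rfl fun i _ => inner_toComplex _ _
  rw [← inner_pureTensor, ← h1, L2.inner_def, L2.inner_def, ← integral_mul_const]
  refine integral_congr_ae ?_
  filter_upwards [(ContinuousLinearMap.toSpanSingleton ℂ (pureTensor x)).coeFn_compLp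
      (pureTensor fun j => toComplex (h j)),
    (ContinuousLinearMap.toSpanSingleton ℂ (pureTensor y)).coeFn_compLp
      (pureTensor fun j => toComplex (k j))] with t h2 h3
  unfold elementary
  rw [h2, h3, ContinuousLinearMap.toSpanSingleton_apply,
    ContinuousLinearMap.toSpanSingleton_apply, inner_smul_left, inner_smul_right]
  simp only [RCLike.inner_apply]
  ring

lemma elementary_update_add {p : ℕ} (h : Fin p → RealL2) (x : Fin (p + 1) → Fock)
    (j : Fin (p + 1)) (ξ η : Fock) :
    elementary h (Function.update x j (ξ + η))
      = elementary h (Function.update x j ξ) + elementary h (Function.update x j η) := by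
  unfold elementary
  rw [pureTensor_update_add, ContinuousLinearMap.toSpanSingleton_add,
    ContinuousLinearMap.add_compLp]

lemma elementary_update_smul {p : ℕ} (h : Fin p → RealL2) (x : Fin (p + 1) → Fock)
    (j : Fin (p + 1)) (c : ℂ) (ξ : Fock) :
    elementary h (Function.update x j (c • ξ)) = c • elementary h (Function.update x j ξ) := by
  unfold elementary
  rw [pureTensor_update_smul, ContinuousLinearMap.toSpanSingleton_smul,
    ContinuousLinearMap.smul_compLp]

/-- Multilinearity in the legs, by induction on the set `k` of legs that are allowed to be in the
span rather than in `s`. -/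
lemma elementary_mem_of_span {p : ℕ} (h : Fin p → RealL2) {M : Submodule ℂ (MultiProcess p)}
    {s : Set Fock} (hM : ∀ x : Fin (p + 1) → Fock, (∀ j, x j ∈ s) → elementary h x ∈ M)
    {x : Fin (p + 1) → Fock} (hx : ∀ j, x j ∈ Submodule.span ℂ s) : elementary h x ∈ M := by
  have key : ∀ (k : Finset (Fin (p + 1))) (x : Fin (p + 1) → Fock),
      (∀ j ∈ k, x j ∈ Submodule.span ℂ s) → (∀ j ∉ k, x j ∈ s) → elementary h x ∈ M := by
    intro k
    induction k using Finset.induction_on with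
    | empty => exact fun x _ h2 => hM x fun j => h2 j (Finset.notMem_empty j)
    | insert i k hi ih =>
      intro x h1 h2
      rw [← Function.update_eq_self i x]
      refine Submodule.span_induction
        (p := fun y _ => elementary h (Function.update x i y) ∈ M) ?_ ?_ ?_ ?_
        (h1 i (Finset.mem_insert_self i k))
      · intro y hy
        refine ih _ (fun j hj => ?_) fun j hj => ?_
        · have hji : j ≠ i := fun hji => hi (hji ▸ hj)
          rw [Function.update_of_ne hji]
          exact h1 j (Finset.mem_insert_of_mem hj)
        · by_cases hji : j = i
          · subst hji
            rwa [Function.update_self]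
          · rw [Function.update_of_ne hji]
            exact h2 j (by simp [hji, hj])
      · rw [← zero_smul ℂ (0 : Fock), elementary_update_smul, zero_smul]
        exact M.zero_mem
      · intro y z _ _ hy hz
        rw [elementary_update_add]
        exact M.add_mem hy hz
      · intro c y _ hy
        rw [elementary_update_smul]
        exact M.smul_mem c hy
  exact key Finset.univ x (fun j _ => hx j) fun j hj => absurd (Finset.mem_univ j) hj

/-! ### Monomials and elementary tensors -/

/-- The vectors `(l(h₁) + ε l(h₁)*) ⋯ (l(hₙ) + ε l(hₙ)*) Ω`: elementary tensors for `ε = 0` and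
monomials for `ε = 1`. -/
def mixedVec (ε : ℝ) : List RealL2 → Fock
  | [] => vacuum
  | h :: w => cre h (mixedVec ε w) + (ε : ℂ) • ann h (mixedVec ε w)

lemma mixedVec_zero : ∀ w, mixedVec 0 w = tens w
  | [] => rfl
  | h :: w => by simp [mixedVec, mixedVec_zero w]

lemma wordVec_cons (h : RealL2) (w : List RealL2) :
    wordVec (h :: w) = semicircular h (wordVec w) := by
  simp [wordVec, wordOp]

lemma mixedVec_one : ∀ w, mixedVec 1 w = wordVec w
  | [] => rfl
  | h :: w => by simp [mixedVec, mixedVec_one w, wordVec_cons, semicircular_eq]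

/-- The span of the elementary tensors of order at most `n`. -/
def tensSpan (n : ℕ) : Submodule ℂ Fock := Submodule.span ℂ (tens '' {w | w.length ≤ n})

/-- The span of the monomials of degree at most `n`. -/
def wordSpan (n : ℕ) : Submodule ℂ Fock := Submodule.span ℂ (wordVec '' {w | w.length ≤ n})

lemma semicircular_mem_span {u u' : List RealL2 → Fock} {n : ℕ} {h : RealL2}
    (hu : ∀ w : List RealL2, w.length ≤ n → semicircular h (u w) ∈
      Submodule.span ℂ (u' '' {w | w.length ≤ n + 1})) {ξ : Fock}
    (hξ : ξ ∈ Submodule.span ℂ (u '' {w | w.length ≤ n})) :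
    semicircular h ξ ∈ Submodule.span ℂ (u' '' {w | w.length ≤ n + 1}) := by
  have : Submodule.span ℂ (u '' {w | w.length ≤ n}) ≤
      (Submodule.span ℂ (u' '' {w | w.length ≤ n + 1})).comap (semicircular h).toLinearMap := by
    rw [Submodule.span_le]
    rintro _ ⟨w, hw, rfl⟩
    exact hu w hw
  exact this hξ

lemma wordVec_mem_tensSpan : ∀ w : List RealL2, wordVec w ∈ tensSpan w.length
  | [] => Submodule.subset_span ⟨[], by simp, rfl⟩
  | h :: w => by
    rw [wordVec_cons, List.length_cons]
    refine semicircular_mem_span (fun v hv => ?_) (wordVec_mem_tensSpan w)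
    rw [semicircular_eq, add_apply]
    refine Submodule.add_mem _ (Submodule.subset_span ⟨h :: v, by simpa using hv, rfl⟩) ?_
    cases v with
    | nil =>
      rw [tens_nil, ann_vacuum]
      exact Submodule.zero_mem _
    | cons k v =>
      rw [ann_tens_cons]
      simp only [List.length_cons] at hv
      exact Submodule.smul_mem _ _ (Submodule.subset_span ⟨v, by simp; omega, rfl⟩)

lemma wordSpan_mono {m n : ℕ} (h : m ≤ n) : wordSpan m ≤ wordSpan n :=
  Submodule.span_mono (Set.image_mono fun _ hw => le_trans hw h)

/-- The change from monomials to tensors is triangular: h ⊗ ξ is S(h) ξ minus a contraction that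
lowers the order. -/
lemma tens_mem_wordSpan : ∀ w : List RealL2, tens w ∈ wordSpan w.length
  | [] => Submodule.subset_span ⟨[], by simp, rfl⟩
  | h :: w => by
    have h1 : semicircular h (tens w) ∈ wordSpan (h :: w).length :=
      semicircular_mem_span (fun v hv => Submodule.subset_span
        ⟨h :: v, by simpa using hv, wordVec_cons h v⟩) (tens_mem_wordSpan w)
    have h2 : ann h (tens w) ∈ wordSpan (h :: w).length := by
      cases w with
      | nil =>
        rw [tens_nil, ann_vacuum]
        exact Submodule.zero_mem _
      | cons k v =>
        rw [ann_tens_cons]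
        exact Submodule.smul_mem _ _ (wordSpan_mono (by simp; omega) (tens_mem_wordSpan v))
    have : tens (h :: w) = semicircular h (tens w) - ann h (tens w) := by
      rw [tens_cons, semicircular_eq, add_apply, add_sub_cancel_right]
    rw [this]
    exact Submodule.sub_mem _ h1 h2

/-! ### The adjoint of the iterated derivative -/

/-- The word `v₀ g₁ v₁ g₂ v₂ ⋯ g_p v_p`. -/
def glue : (p : ℕ) → (Fin p → RealL2) → (Fin (p + 1) → List RealL2) → List RealL2
  | 0, _, v => v 0
  | p + 1, g, v => v 0 ++ g 0 :: glue p (Fin.tail g) (Fin.tail v)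

lemma mem_cuts : ∀ {w : List RealL2} {c : List RealL2 × RealL2 × List RealL2}, c ∈ cuts w →
    c.1 ++ c.2.1 :: c.2.2 = w
  | h :: w, c, hc => by
    rw [cuts, List.mem_cons, List.mem_map] at hc
    rcases hc with rfl | ⟨d, hd, rfl⟩
    · rfl
    · simp [mem_cuts hd]

lemma glue_of_mem_iterCuts : ∀ {p : ℕ} {w : List RealL2}
    {d : (Fin p → RealL2) × (Fin (p + 1) → List RealL2)}, d ∈ iterCuts p w → glue p d.1 d.2 = w
  | 0, w, d, hd => by
    rw [iterCuts, List.mem_singleton] at hd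
    rw [hd]; rfl
  | p + 1, w, d, hd => by
    rw [iterCuts, List.mem_flatMap] at hd
    obtain ⟨c, hc, hd⟩ := hd
    obtain ⟨d', hd', rfl⟩ := List.mem_map.1 hd
    have : glue p d'.1 d'.2 = c.2.2 := glue_of_mem_iterCuts hd'
    simp only [glue, Fin.cons_zero, Fin.tail_cons]
    rw [this, mem_cuts hc]

lemma length_cuts : ∀ w : List RealL2, (cuts w).length = w.length
  | [] => rfl
  | h :: w => by simp [cuts, length_cuts w]

lemma length_iterCuts_le : ∀ (p : ℕ) {n : ℕ} {w : List RealL2}, w.length ≤ n →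
    (iterCuts p w).length ≤ n ^ p
  | 0, n, w, _ => by simp [iterCuts]
  | p + 1, n, w, hw => by
    rw [iterCuts, List.length_flatMap]
    refine (List.sum_le_card_nsmul _ (n ^ p) ?_).trans ?_
    · intro m hm
      obtain ⟨c, hc, rfl⟩ := List.mem_map.1 hm
      rw [List.length_map]
      refine length_iterCuts_le p (le_trans ?_ hw)
      rw [← mem_cuts hc]
      simp
      omega
    · rw [List.length_map, length_cuts, smul_eq_mul, pow_succ, mul_comm]
      gcongr

lemma inner_mixedVec_cons (ε : ℝ) (ξ : Fock) (h : RealL2) (w : List RealL2) :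
    inner ℂ ξ (mixedVec ε (h :: w))
      = inner ℂ (ann h ξ) (mixedVec ε w) + ε * inner ℂ (cre h ξ) (mixedVec ε w) := by
  rw [mixedVec, inner_add_right, inner_smul_right, inner_ann_left, inner_cre_left]

/-- Cutting is adjoint to gluing. The first letter `h` of `w` moves to the left side as l(h)* + ε
l(h). Its creation part lengthens `v`, whence the induction over all `v`; its annihilation part
shortens `v`, or meets `g` when `v` is empty, which accounts for the cut at `h`. A single proof over
`ε` covers both monomials and elementary tensors. -/
lemma sum_cuts (ε : ℝ) (g : RealL2) (z : List RealL2) : ∀ w v : List RealL2,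
    ((cuts w).map fun c => ((inner ℝ g c.2.1 : ℝ) : ℂ) * (inner ℂ (tens v) (mixedVec ε c.1)
      * inner ℂ (tens z) (mixedVec ε c.2.2))).sum
      = inner ℂ (tens (v ++ g :: z)) (mixedVec ε w)
  | [], v => by
    change 0 = inner ℂ _ (tens [])
    rw [inner_tens, wordInner_of_length_ne]
    simp
  | h :: w, v => by
    have h2 := sum_cuts ε g z w (h :: v)
    rw [inner_mixedVec_cons, cuts, List.map_cons, List.sum_cons, List.map_map]
    simp only [Function.comp_def, inner_mixedVec_cons]
    cases v with
    | nil =>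
      simp only [tens_nil, ann_vacuum, inner_zero_left, zero_add, List.nil_append, tens_cons,
        ann_cre, inner_smul_left, Complex.conj_ofReal] at h2 ⊢
      rw [show mixedVec ε [] = vacuum from rfl, inner_vacuum_self, real_inner_comm g h]
      simp only [List.cons_append, tens_cons, List.nil_append] at h2
      rw [← h2, ← List.sum_map_mul_left, one_mul]
      congr 3
      funext c
      ring
    | cons k v =>
      have h1 := sum_cuts ε g z w v
      simp only [List.cons_append, tens_cons, ann_cre, inner_smul_left, Complex.conj_ofReal]
        at h2 ⊢
      rw [← h1, ← h2, ← List.sum_map_mul_left, ← List.sum_map_mul_left, ← List.sum_map_add,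
        inner_cre_left, show mixedVec ε [] = vacuum from rfl, ann_vacuum, inner_zero_right,
        zero_mul, mul_zero, zero_add]
      congr 2
      funext c
      ring

lemma sum_iterCuts (ε : ℝ) : ∀ (p : ℕ) (g : Fin p → RealL2) (v : Fin (p + 1) → List RealL2)
    (w : List RealL2),
    ((iterCuts p w).map fun d => (∏ i, ((inner ℝ (g i) (d.1 i) : ℝ) : ℂ))
      * ∏ j, inner ℂ (tens (v j)) (mixedVec ε (d.2 j))).sum
      = inner ℂ (tens (glue p g v)) (mixedVec ε w)
  | 0, g, v, w => by simp [iterCuts, glue]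
  | p + 1, g, v, w => by
    rw [glue, ← sum_cuts, iterCuts, List.map_flatMap, List.flatMap_def,
      List.sum_flatten, List.map_map]
    congr 2
    funext c
    rw [Function.comp_apply, ← sum_iterCuts ε p, List.map_map, ← List.sum_map_mul_left, ← List.sum_map_mul_left]
    congr 2
    funext d
    simp only [Function.comp_apply, Fin.prod_univ_succ (n := p), Fin.prod_univ_succ (n := p + 1),
      Fin.cons_zero, Fin.cons_succ, Fin.tail]
    ring

/-- The iterated derivative of an elementary tensor. -/
def nablaTens (p : ℕ) (w : List RealL2) : MultiProcess p :=
  ((iterCuts p w).map fun d => elementary d.1 fun j => tens (d.2 j)).sum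

lemma inner_list_sum {E α : Type*} [NormedAddCommGroup E] [InnerProductSpace ℂ E] (x : E)
    (l : List α) (f : α → E) : inner ℂ x (l.map f).sum = (l.map fun a => inner ℂ x (f a)).sum := by
  change innerSL ℂ x _ = _
  rw [map_list_sum, List.map_map]
  rfl

lemma inner_elementary_nablaWord (p : ℕ) (g : Fin p → RealL2) (v : Fin (p + 1) → List RealL2)
    (w : List RealL2) :
    inner ℂ (elementary g fun j => tens (v j)) (nablaWord p w)
      = inner ℂ (tens (glue p g v)) (wordVec w) := by
  rw [nablaWord, inner_list_sum, ← mixedVec_one, ← sum_iterCuts]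
  simp only [inner_elementary, mixedVec_one]

lemma inner_elementary_nablaTens (p : ℕ) (g : Fin p → RealL2) (v : Fin (p + 1) → List RealL2)
    (w : List RealL2) :
    inner ℂ (elementary g fun j => tens (v j)) (nablaTens p w)
      = inner ℂ (tens (glue p g v)) (tens w) := by
  rw [nablaTens, inner_list_sum, ← mixedVec_zero w, ← sum_iterCuts]
  simp only [inner_elementary, mixedVec_zero]

/-- Every term of `nablaTens p v` glues back to `v`, so each contributes the same scalar product.
Thus ∇^p preserves orthogonality of basis tensors. -/
lemma inner_nablaTens (p : ℕ) (v w : List RealL2) :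
    inner ℂ (nablaTens p v) (nablaTens p w)
      = (iterCuts p v).length * inner ℂ (tens v) (tens w) := by
  rw [← inner_conj_symm]
  nth_rw 2 [nablaTens]
  rw [inner_list_sum, map_list_sum, List.map_map, ← nsmul_eq_mul]
  rw [List.map_congr_left (g := fun _ => inner ℂ (tens v) (tens w)) fun d hd => ?_]
  · rw [List.map_const', List.sum_replicate]
  · rw [Function.comp_apply, inner_conj_symm, inner_elementary_nablaTens,
      glue_of_mem_iterCuts hd]

/-! ### Closability of the iterated derivative -/

/-- The span of the elementary multiprocesses whose legs are elementary tensors. -/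
def testSpan (p : ℕ) : Submodule ℂ (MultiProcess p) :=
  Submodule.span ℂ {y | ∃ (g : Fin p → RealL2) (v : Fin (p + 1) → List RealL2),
    y = elementary g fun j => tens (v j)}

lemma elementary_mem_testSpan {p : ℕ} (g : Fin p → RealL2) (v : Fin (p + 1) → List RealL2) :
    elementary g (fun j => tens (v j)) ∈ testSpan p :=
  Submodule.subset_span ⟨g, v, rfl⟩

lemma nablaTens_mem_testSpan (p : ℕ) (w : List RealL2) : nablaTens p w ∈ testSpan p := by
  refine list_sum_mem fun y hy => ?_
  obtain ⟨d, -, rfl⟩ := List.mem_map.1 hy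
  exact elementary_mem_testSpan _ _

lemma nablaWord_mem_testSpan (p : ℕ) (w : List RealL2) : nablaWord p w ∈ testSpan p := by
  refine list_sum_mem fun y hy => ?_
  obtain ⟨d, -, rfl⟩ := List.mem_map.1 hy
  refine elementary_mem_of_span _ (s := Set.range tens) (fun x hx => ?_) fun j => ?_
  · choose v hv using hx
    rw [← funext hv]
    exact elementary_mem_testSpan _ _
  · exact Submodule.span_mono (Set.image_subset_range _ _) (wordVec_mem_tensSpan (d.2 j))

lemma eq_zero_of_inner_elementary {p : ℕ} {y : MultiProcess p}
    (hy : y ∈ (testSpan p).topologicalClosure)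
    (h0 : ∀ (g : Fin p → RealL2) (v : Fin (p + 1) → List RealL2),
      inner ℂ (elementary g fun j => tens (v j)) y = 0) : y = 0 := by
  have h1 : y ∈ (testSpan p)ᗮ := by
    rw [Submodule.mem_orthogonal]
    intro u hu
    refine Submodule.span_induction (p := fun u _ => inner ℂ u y = 0) ?_ ?_ ?_ ?_ hu
    · rintro _ ⟨g, v, rfl⟩
      exact h0 g v
    · exact inner_zero_left _
    · intro a b _ _ ha hb
      rw [inner_add_left, ha, hb, add_zero]
    · intro c a _ ha
      rw [inner_smul_left, ha, mul_zero]
  rw [← Submodule.orthogonal_closure] at h1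
  exact inner_self_eq_zero.1 ((Submodule.mem_orthogonal _ _).1 h1 y hy)

/-- The graph of `∇^p` on the algebra of the monomials. -/
def nablaGraph (p : ℕ) : Submodule ℂ (Fock × MultiProcess p) :=
  Submodule.span ℂ (Set.range fun w => (wordVec w, nablaWord p w))

/-- Both conclusions are closed linear conditions that hold on monomials. Together they determine
the second component from the first, which yields closability. -/
lemma mem_closure_nablaGraph {p : ℕ} {z : Fock × MultiProcess p}
    (hz : z ∈ (nablaGraph p).topologicalClosure) :
    z.2 ∈ (testSpan p).topologicalClosure ∧
    ∀ (g : Fin p → RealL2) (v : Fin (p + 1) → List RealL2),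
      inner ℂ (elementary g fun j => tens (v j)) z.2 = inner ℂ (tens (glue p g v)) z.1 := by
  constructor
  · have : nablaGraph p ≤ (testSpan p).topologicalClosure.comap (LinearMap.snd ℂ _ _) := by
      refine Submodule.span_le.2 ?_
      rintro _ ⟨w, rfl⟩
      exact Submodule.le_topologicalClosure _ (nablaWord_mem_testSpan p w)
    exact Submodule.topologicalClosure_minimal _ this
      ((Submodule.isClosed_topologicalClosure _).preimage continuous_snd) hz
  · intro g v
    have : nablaGraph p ≤ LinearMap.ker
        ((innerSL ℂ (elementary g fun j => tens (v j)) ∘L ContinuousLinearMap.snd ℂ _ _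
          - innerSL ℂ (tens (glue p g v)) ∘L ContinuousLinearMap.fst ℂ _ _ :
          Fock × MultiProcess p →L[ℂ] ℂ)).toLinearMap := by
      refine Submodule.span_le.2 ?_
      rintro _ ⟨w, rfl⟩
      refine LinearMap.mem_ker.2 (sub_eq_zero.2 ?_)
      exact inner_elementary_nablaWord p g v w
    exact sub_eq_zero.1 (LinearMap.mem_ker.1 (Submodule.topologicalClosure_minimal _ this
      (ContinuousLinearMap.isClosed_ker _) hz))

lemma eq_zero_of_mem_closure_nablaGraph {p : ℕ} {z : Fock × MultiProcess p}
    (hz : z ∈ (nablaGraph p).topologicalClosure) (h0 : z.1 = 0) : z.2 = 0 := by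
  obtain ⟨h1, h2⟩ := mem_closure_nablaGraph hz
  exact eq_zero_of_inner_elementary h1 fun g v => by rw [h2, h0, inner_zero_right]

/-- A span of pairs defines an operator only if it is single-valued, and the operator is closable
only if the closure is too; both follow from `eq_zero_of_mem_closure_nablaGraph`. -/
lemma graph_nabla (p : ℕ) : (nabla p).graph = (nablaGraph p).topologicalClosure := by
  have h1 : (nablaAlg p).graph = nablaGraph p := Submodule.toLinearPMap_graph_eq _ fun z hz h0 =>
    eq_zero_of_mem_closure_nablaGraph (Submodule.le_topologicalClosure _ hz) h0
  have h2 : (nablaAlg p).IsClosable := by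
    refine ⟨(nablaGraph p).topologicalClosure.toLinearPMap, ?_⟩
    rw [h1, Submodule.toLinearPMap_graph_eq _ fun z hz h0 =>
      eq_zero_of_mem_closure_nablaGraph hz h0]
  rw [nabla, ← h2.graph_closure_eq_closure_graph, h1]

/-- The tensor is a combination of monomials, so it has some derivative `y` in the graph. Both `y`
and `nablaTens p w` satisfy the duality with test multiprocesses and lie in their closed span, so
they agree without any expansion. -/
lemma tens_mem_nablaGraph (p : ℕ) (w : List RealL2) : (tens w, nablaTens p w) ∈ nablaGraph p := by
  have h1 : tens w ∈ (nablaGraph p).map (LinearMap.fst ℂ _ _) := by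
    rw [nablaGraph, Submodule.map_span, ← Set.range_comp]
    exact Submodule.span_mono (Set.image_subset_range _ _) (tens_mem_wordSpan w)
  obtain ⟨⟨x, y⟩, hz, rfl : x = tens w⟩ := h1
  obtain ⟨h2, h3⟩ := mem_closure_nablaGraph (Submodule.le_topologicalClosure _ hz)
  have h4 : y - nablaTens p w = 0 := by
    refine eq_zero_of_inner_elementary (Submodule.sub_mem _ h2 (Submodule.le_topologicalClosure _
      (nablaTens_mem_testSpan p w))) fun g v => ?_
    rw [inner_sub_right, inner_elementary_nablaTens]
    exact sub_eq_zero.2 (h3 g v)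
  rwa [← sub_eq_zero.1 h4]

/-! ### Boundedness of the derivative on vectors of bounded order. -/

section Basis

variable {ι : Type} (e : HilbertBasis ι ℝ RealL2)

open Classical in
/-- The values of `nablaExt` on the basis. -/
def nablaBasis (p n : ℕ) (w : List ι) : MultiProcess p :=
  if w.length ≤ n then nablaTens p (w.map e) else 0

/-- The images of the basis vectors are pairwise orthogonal, with squared norm the number of cuts,
at most n^p. -/
lemma norm_nablaBasis_le (p n : ℕ) (c : List ι →₀ ℂ) :
    ‖Finsupp.linearCombination ℂ (nablaBasis e p n) c‖
      ≤ √((n : ℝ) ^ p) * ‖Finsupp.linearCombination ℂ (bvec e) c‖ := by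
  classical
  refine abs_le_of_sq_le_sq' ?_ (by positivity) |>.2
  rw [mul_pow, Real.sq_sqrt (by positivity), norm_sq_linearCombination (orthonormal_bvec e)]
  have hin : ∀ v w : List ι, inner ℂ (nablaBasis e p n v) (nablaBasis e p n w)
      = if v = w then
        (((if v.length ≤ n then (iterCuts p (v.map e)).length else 0 : ℕ) : ℝ) : ℂ) else 0 := by
    intro v w
    unfold nablaBasis
    by_cases hvw : v = w
    · subst hvw
      rw [if_pos rfl]
      split_ifs
      · rw [inner_nablaTens, inner_tens, wordInner_map, if_pos rfl, mul_one]
        push_cast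
        rfl
      · simp
    · by_cases hv : v.length ≤ n <;> by_cases hw : w.length ≤ n <;>
        simp [hv, hw, hvw, inner_nablaTens, inner_tens, wordInner_map]
  have hn : ‖Finsupp.linearCombination ℂ (nablaBasis e p n) c‖ ^ 2 = ∑ w ∈ c.support, ‖c w‖ ^ 2 *
      ((if w.length ≤ n then (iterCuts p (w.map e)).length else 0 : ℕ) : ℝ) := by
    refine Complex.ofReal_injective ?_
    rw [Complex.ofReal_pow]
    refine (inner_self_eq_norm_sq_to_K (𝕜 := ℂ)
      (Finsupp.linearCombination ℂ (nablaBasis e p n) c)).symm.trans ?_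
    rw [Complex.ofReal_sum, Finsupp.linearCombination_apply, Finsupp.sum, sum_inner]
    refine Finset.sum_congr rfl fun v hv => ?_
    rw [inner_sum, Finset.sum_eq_single_of_mem v hv]
    · rw [inner_smul_left, inner_smul_right, hin, if_pos rfl, ← mul_assoc,
        ← Complex.normSq_eq_conj_mul_self, Complex.normSq_eq_norm_sq, Complex.ofReal_mul]
    · intro w _ hne
      rw [inner_smul_left, inner_smul_right, hin, if_neg hne.symm, mul_zero, mul_zero]
  rw [hn, Finset.mul_sum]
  refine Finset.sum_le_sum fun w _ => ?_
  rw [mul_comm]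
  gcongr
  split_ifs with hw
  · exact_mod_cast length_iterCuts_le p (by simpa using hw)
  · simp

/-- The restriction of `∇^p` to the vectors of order at most `n`, extended by zero. -/
def nablaExt (p n : ℕ) : Fock →L[ℂ] MultiProcess p := basisExt e (nablaBasis e p n)

lemma nablaExt_bvec (p n : ℕ) (w : List ι) : nablaExt e p n (bvec e w) = nablaBasis e p n w :=
  basisExt_bvec e (norm_nablaBasis_le e p n) w

lemma mem_graph_nabla {p n : ℕ} {S : Set (List ι)} (hS : ∀ w ∈ S, w.length ≤ n) {ξ : Fock}
    (hξ : ξ ∈ (Submodule.span ℂ (bvec e '' S)).topologicalClosure) :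
    (ξ, nablaExt e p n ξ) ∈ (nabla p).graph := by
  rw [graph_nabla]
  have : Submodule.span ℂ (bvec e '' S) ≤ (nablaGraph p).topologicalClosure.comap
      (LinearMap.id.prod (nablaExt e p n).toLinearMap) := by
    refine Submodule.span_le.2 ?_
    rintro _ ⟨w, hw, rfl⟩
    refine Submodule.le_topologicalClosure _ ?_
    change (bvec e w, nablaExt e p n (bvec e w)) ∈ _
    rw [nablaExt_bvec, nablaBasis, if_pos (hS w hw)]
    exact tens_mem_nablaGraph p _
  exact Submodule.topologicalClosure_minimal _ this ((Submodule.isClosed_topologicalClosure _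
    ).preimage (continuous_id.prodMk (nablaExt e p n).continuous)) hξ

end Basis

/-! ### Words produced by the iterated derivative -/

lemma length_le_length_glue : ∀ (p : ℕ) (g : Fin p → RealL2) (v : Fin (p + 1) → List RealL2)
    (j : Fin (p + 1)), (v j).length ≤ (glue p g v).length
  | 0, g, v, j => by
    obtain rfl : j = 0 := Fin.eq_zero j
    exact le_rfl
  | p + 1, g, v, j => by
    rw [glue, List.length_append, List.length_cons]
    cases j using Fin.cases with
    | zero => omega
    | succ j =>
      have := length_le_length_glue p (Fin.tail g) (Fin.tail v) j
      change (v j.succ).length ≤ _ at this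
      omega

lemma glue_update_last : ∀ (p : ℕ) (g : Fin p → RealL2) (z : List RealL2),
    glue p g (Function.update (fun _ => []) (Fin.last p) z) = List.ofFn g ++ z
  | 0, g, z => by simp [glue]
  | p + 1, g, z => by
    rw [glue, ← Fin.succ_last, Fin.tail_update_succ,
      Function.update_of_ne (Fin.succ_ne_zero _).symm, List.ofFn_succ]
    have := glue_update_last p (Fin.tail g) z
    change [] ++ g 0 :: glue p (Fin.tail g) (Function.update (fun _ => []) (Fin.last p) z) = _
    rw [this]
    rfl

lemma glue_of_succ_eq_nil : ∀ (p : ℕ) (g : Fin p → RealL2) (v : Fin (p + 1) → List RealL2),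
    (∀ i : Fin p, v i.succ = []) → glue p g v = v 0 ++ List.ofFn g
  | 0, g, v, _ => by simp [glue]
  | p + 1, g, v, h => by
    rw [glue, glue_of_succ_eq_nil p _ _ fun i => h i.succ, List.ofFn_succ]
    change v 0 ++ g 0 :: (v (Fin.succ 0) ++ _) = _
    rw [h 0]
    rfl

lemma ofFn_comp_rev {α : Type*} {p : ℕ} (f : Fin p → α) :
    (List.ofFn fun i => f i.rev) = (List.ofFn f).reverse := by
  refine List.ext_getElem (by simp) fun i h1 _ => ?_
  rw [List.length_ofFn] at h1
  simp only [List.getElem_ofFn, List.getElem_reverse, List.length_ofFn]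
  congr 1
  ext
  simp only [Fin.val_rev]
  omega

lemma inner_vacuum_tens (w : List RealL2) :
    inner ℂ vacuum (tens w) = if w = [] then (1 : ℂ) else 0 := by
  rw [← tens_nil, inner_tens]
  cases w <;> simp [wordInner]

lemma sum_iterCuts_succ {p : ℕ} {w : List RealL2}
    (f : (Fin (p + 1) → RealL2) × (Fin (p + 2) → List RealL2) → ℂ) :
    ((iterCuts (p + 1) w).map f).sum = ((cuts w).map fun c =>
      ((iterCuts p c.2.2).map fun d => f (Fin.cons c.2.1 d.1, Fin.cons c.1 d.2)).sum).sum := by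
  rw [iterCuts, List.map_flatMap, List.flatMap_def, List.sum_flatten, List.map_map]
  congr 2
  funext c
  rw [Function.comp_apply, List.map_map]
  rfl

lemma sum_iterCuts_vacuum : ∀ (p : ℕ) (w : List RealL2),
    ((iterCuts p w).map fun d => ∏ j, inner ℂ vacuum (tens (d.2 j))).sum
      = if w.length = p then (1 : ℂ) else 0
  | 0, w => by simp [iterCuts, inner_vacuum_tens]
  | p + 1, [] => by simp [iterCuts, cuts]
  | p + 1, h :: w => by
    rw [sum_iterCuts_succ, cuts, List.map_cons, List.sum_cons, List.map_map]
    simp only [Function.comp_def, Fin.prod_univ_succ (n := p + 1), Fin.cons_zero, Fin.cons_succ,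
      List.sum_map_mul_left, sum_iterCuts_vacuum p]
    simp only [inner_vacuum_tens]
    simp

/-- All legs after the first are empty only when the deleted letters are the last p ones; there is
exactly one such term, provided the word has at least p letters. -/
lemma sum_iterCuts_vacuum_succ : ∀ (p : ℕ) (w : List RealL2),
    ((iterCuts p w).map fun d => ∏ i : Fin p, inner ℂ vacuum (tens (d.2 i.succ))).sum
      = if p ≤ w.length then (1 : ℂ) else 0
  | 0, w => by simp [iterCuts]
  | p + 1, w => by
    rw [sum_iterCuts_succ]
    simp only [Fin.cons_succ, sum_iterCuts_vacuum p]
    induction w with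
    | nil => simp [cuts]
    | cons h w ih =>
      rw [cuts, List.map_cons, List.sum_cons, List.map_map]
      simp only [Function.comp_def]
      rw [ih, List.length_cons]
      split_ifs <;> first | omega | simp

/-! ### Slices of multiprocesses -/

/-- The process `t ↦ h₁(t₁) ⋯ h_p(t_p) ξ`. -/
def simpleProc {p : ℕ} (h : Fin p → RealL2) (ξ : Fock) : Lp Fock 2 (lebPow p) :=
  (ContinuousLinearMap.toSpanSingleton ℂ ξ).compLp (pureTensor fun j => toComplex (h j))

lemma coeFn_pureTensor_toComplex {p : ℕ} (h : Fin p → RealL2) :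
    ∀ᵐ t ∂lebPow p, pureTensor (fun j => toComplex (h j)) t = ∏ j, ((h j (t j) : ℝ) : ℂ) := by
  have h1 : ∀ᵐ t ∂lebPow p, ∀ j, toComplex (h j) (t j) = ((h j (t j) : ℝ) : ℂ) :=
    ae_all_iff.2 fun j => (Measure.quasiMeasurePreserving_eval (fun _ : Fin p => leb) j).ae
      (Complex.ofRealCLM.coeFn_compLp (h j))
  filter_upwards [(memLp_pureTensor fun j => toComplex (h j)).coeFn_toLp, h1] with t h2 h3
  refine h2.trans ?_
  simp only [h3]

lemma coeFn_simpleProc {p : ℕ} (h : Fin p → RealL2) (ξ : Fock) :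
    ∀ᵐ t ∂lebPow p, simpleProc h ξ t = (∏ j, ((h j (t j) : ℝ) : ℂ)) • ξ := by
  filter_upwards [(ContinuousLinearMap.toSpanSingleton ℂ ξ).coeFn_compLp
    (pureTensor fun j => toComplex (h j)), coeFn_pureTensor_toComplex h] with t h1 h2
  rw [← h2]
  exact h1

lemma coeFn_elementary {p : ℕ} (h : Fin p → RealL2) (x : Fin (p + 1) → Fock) :
    ∀ᵐ t ∂lebPow p, elementary h x t = (∏ j, ((h j (t j) : ℝ) : ℂ)) • pureTensor x := by
  filter_upwards [(ContinuousLinearMap.toSpanSingleton ℂ (pureTensor x)).coeFn_compLp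
    (pureTensor fun j => toComplex (h j)), coeFn_pureTensor_toComplex h] with t h1 h2
  rw [← h2]
  exact h1

/-- The slice map on multiprocesses, applied pointwise. -/
def sliceL {p : ℕ} (j : Fin (p + 1)) : MultiProcess p →L[ℂ] Lp Fock 2 (lebPow p) :=
  (slice j).compLpL 2 (lebPow p)

lemma coeFn_sliceL {p : ℕ} (j : Fin (p + 1)) (y : MultiProcess p) :
    ∀ᵐ t ∂lebPow p, sliceL j y t = slice j (y t) :=
  (slice j).coeFn_compLp y

lemma sliceL_elementary {p : ℕ} (j : Fin (p + 1)) (h : Fin p → RealL2)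
    (x : Fin (p + 1) → Fock) :
    sliceL j (elementary h x)
      = (∏ i ∈ Finset.univ.erase j, inner ℂ vacuum (x i)) • simpleProc h (x j) := by
  refine Lp.ext ?_
  filter_upwards [coeFn_sliceL j (elementary h x), coeFn_elementary h x,
    Lp.coeFn_smul (∏ i ∈ Finset.univ.erase j, inner ℂ vacuum (x i)) (simpleProc h (x j)),
    coeFn_simpleProc h (x j)] with t h1 h2 h3 h4
  rw [h1, h2, h3, Pi.smul_apply, h4, map_smul, slice_pureTensor, smul_comm]

lemma inner_simpleProc_sliceL {p : ℕ} (j : Fin (p + 1)) (h : Fin p → RealL2) (ξ : Fock)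
    (y : MultiProcess p) :
    inner ℂ (simpleProc h ξ) (sliceL j y)
      = inner ℂ (elementary h (Function.update (fun _ => vacuum) j ξ)) y := by
  rw [L2.inner_def, L2.inner_def]
  refine integral_congr_ae ?_
  filter_upwards [coeFn_sliceL j y, coeFn_elementary h (Function.update (fun _ => vacuum) j ξ),
    coeFn_simpleProc h ξ] with t h1 h2 h3
  rw [h1, h2, h3, inner_smul_left, inner_smul_left, slice,
    ContinuousLinearMap.adjoint_inner_right]
  rfl

lemma measurePreserving_rev (p : ℕ) :
    MeasurePreserving (fun t : Fin p → ℝ => t ∘ Fin.rev) (lebPow p) (lebPow p) := by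
  have h := measurePreserving_piCongrLeft (fun _ : Fin p => leb) Fin.revPerm
  convert h using 1
  funext t i
  have := MeasurableEquiv.piCongrLeft_apply_apply (β := fun _ : Fin p => ℝ) Fin.revPerm t (Fin.rev i)
  rw [Fin.revPerm_apply, Fin.rev_rev] at this
  exact this.symm

/-- Reversal of the time variables of a process. -/
def timeRev (p : ℕ) : Lp Fock 2 (lebPow p) →L[ℂ] Lp Fock 2 (lebPow p) :=
  (Lp.compMeasurePreservingₗᵢ ℂ (fun t : Fin p → ℝ => t ∘ Fin.rev)
    (measurePreserving_rev p)).toContinuousLinearMap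

lemma coeFn_timeRev {p : ℕ} (y : Lp Fock 2 (lebPow p)) :
    ∀ᵐ t ∂lebPow p, timeRev p y t = y (t ∘ Fin.rev) :=
  Lp.coeFn_compMeasurePreserving y (measurePreserving_rev p)

lemma timeRev_simpleProc {p : ℕ} (h : Fin p → RealL2) (ξ : Fock) :
    timeRev p (simpleProc h ξ) = simpleProc (h ∘ Fin.rev) ξ := by
  refine Lp.ext ?_
  filter_upwards [coeFn_timeRev (simpleProc h ξ), coeFn_simpleProc (h ∘ Fin.rev) ξ,
    (measurePreserving_rev p).quasiMeasurePreserving.ae (coeFn_simpleProc h ξ)] with t h1 h2 h3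
  rw [h1, h2, h3]
  congr 1
  rw [← Equiv.prod_comp Fin.revPerm]
  simp

/-- In normal order, every term beginning with a creation operator is orthogonal to the vacuum; what
remains is pure annihilation, whose adjoint creates the reversed word. This reversal is the source
of the reversed times in the formula. -/
lemma inner_vacuum_wick (w : List RealL2) (ξ : Fock) :
    inner ℂ vacuum (wick w ξ) = inner ℂ (tens w.reverse) ξ := by
  have h1 : ∀ v, creWord v vacuum = tens v := by
    intro v
    induction v with
    | nil => rfl
    | cons h v ih => rw [creWord_cons, mul_apply_eq_comp, ih, tens_cons]
  have h2 : inner ℂ vacuum (annWord w ξ) = inner ℂ (tens w.reverse) ξ := by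
    rw [← h1, inner_creWord_left, List.reverse_reverse]
  cases w with
  | nil => exact h2
  | cons h w =>
    rw [wick, add_apply, inner_add_right, h2, mul_apply_eq_comp,
      show inner ℂ vacuum (cre h (wick w ξ)) = 0 from inner_vacuum_creation _ _, add_zero]

/-! ### The trace form and its integral representation by slices. -/

section Basis

variable {ι : Type} (e : HilbertBasis ι ℝ RealL2)

lemma wickVac_of_mem {n : ℕ} {S : Set (List ι)} (hS : ∀ w ∈ S, w.length ≤ n) {ξ : Fock}
    (hξ : ξ ∈ (Submodule.span ℂ (bvec e '' S)).topologicalClosure) : wickVac e n ξ = ξ := by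
  have : Submodule.span ℂ (bvec e '' S) ≤ LinearMap.ker
      ((wickVac e n - 1 : Fock →L[ℂ] Fock)).toLinearMap := by
    refine Submodule.span_le.2 ?_
    rintro _ ⟨w, hw, rfl⟩
    refine LinearMap.mem_ker.2 (sub_eq_zero.2 ?_)
    rw [ContinuousLinearMap.coe_coe, wickVac_bvec, if_pos (hS w hw)]
    rfl
  exact sub_eq_zero.1 (LinearMap.mem_ker.1 (Submodule.topologicalClosure_minimal _ this
    (ContinuousLinearMap.isClosed_ker _) hξ))

lemma wickVac_tens {n : ℕ} {w : List RealL2} (hw : w.length ≤ n) :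
    wickVac e n (tens w) = tens w := by
  refine wickVac_of_mem e (S := {v | v.length ≤ n}) (fun _ h => h)
    (mem_closure_span_bvec e fun v hv => ?_)
  rw [bvec, inner_tens, wordInner_of_length_ne]
  rw [List.length_map]
  rintro h
  exact hv (h.trans_le hw)

/-- Agreement for arbitrary letters comes from the separating vacuum, with no multilinear expansion
in the basis. -/
lemma wickExt_tens {n : ℕ} {w : List RealL2} (hw : w.length ≤ n) :
    wickExt e n (tens w) = wick w := by
  refine sub_eq_zero.1 (eq_zero_of_apply_vacuum e ?_ ?_)
  · exact sub_mem (S := StarSubalgebra ℂ (Fock →L[ℂ] Fock)) (H := SC.toStarSubalgebra)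
      (wickExt_mem_SC e n _) (wick_mem_SC w)
  · rw [sub_apply, ← wickVac_apply, wickVac_tens e hw, wick_vacuum, sub_self]

/-- The legs of a derivative are subwords, so slicing does not raise the order. Hence almost every
slice is a bounded element. -/
lemma wickVac_slice (p n : ℕ) (j : Fin (p + 1)) (ξ : Fock) :
    ∀ᵐ t ∂lebPow p, wickVac e n (slice j (nablaExt e p n ξ t)) = slice j (nablaExt e p n ξ t) := by
  -- As an identity of bounded maps into an L² space it can be checked on basis vectors; pointwise
  -- evaluation is postponed to the end.
  have h0 : ((wickVac e n).compLpL 2 (lebPow p) ∘L sliceL j) ∘L nablaExt e p n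
      = sliceL j ∘L nablaExt e p n := by
    refine ext_bvec e fun w => ?_
    simp only [ContinuousLinearMap.comp_apply, nablaExt_bvec, nablaBasis]
    split_ifs with hw
    · simp only [nablaTens, map_list_sum, List.map_map]
      congr 1
      refine List.map_congr_left fun d hd => ?_
      have hl : (d.2 j).length ≤ n := by
        refine (length_le_length_glue p d.1 d.2 j).trans ?_
        rw [glue_of_mem_iterCuts hd]
        simpa using hw
      simp only [Function.comp_apply, sliceL_elementary, map_smul]
      congr 1
      refine Lp.ext ?_
      filter_upwards [(wickVac e n).coeFn_compLp (simpleProc d.1 (tens (d.2 j))),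
        coeFn_simpleProc d.1 (tens (d.2 j))] with t h1 h2
      refine h1.trans ?_
      rw [h2, map_smul, wickVac_tens e hl]
    · simp
  have h1 : (wickVac e n).compLpL 2 (lebPow p) (sliceL j (nablaExt e p n ξ))
      = sliceL j (nablaExt e p n ξ) := congrArg (fun φ : Fock →L[ℂ] _ => φ ξ) h0
  filter_upwards [(wickVac e n).coeFn_compLp (sliceL j (nablaExt e p n ξ)),
    coeFn_sliceL j (nablaExt e p n ξ)] with t h2 h3
  rw [← h3, ← h2]
  exact congrArg (fun y : Lp Fock 2 (lebPow p) => y t) h1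

/-- The bilinear form `(ξ, η) ↦ τ(X Y)`, where `X Ω = ξ` and `Y Ω = η`. -/
def tauForm (n : ℕ) : Fock →L[ℂ] Fock →L[ℂ] ℂ :=
  ContinuousLinearMap.compL ℂ Fock Fock ℂ (innerSL ℂ vacuum) ∘L
    (ContinuousLinearMap.compL ℂ Fock Fock Fock).flip (wickVac e n) ∘L wickExt e n

lemma tauForm_apply (n : ℕ) (ξ η : Fock) :
    tauForm e n ξ η = tau (wickExt e n ξ * wickExt e n η) := rfl

lemma tauForm_tens {n : ℕ} {w : List RealL2} (hw : w.length ≤ n) (η : Fock) :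
    tauForm e n (tens w) η = inner ℂ (tens w.reverse) (wickVac e n η) := by
  rw [← inner_vacuum_wick, ← wickExt_tens e hw]
  rfl

/-- The bilinear form `(ξ, η) ↦ ∫ τ(X_t Y_t) dt`, where `X_t Ω` and `Y_t Ω` are the slices
of the derivatives of `ξ` and `η`. -/
def slicePairing (p n : ℕ) : Fock →L[ℂ] Fock →L[ℂ] ℂ :=
  (ContinuousLinearMap.compL ℂ Fock (Lp Fock 2 (lebPow p)) ℂ).flip
      (sliceL (Fin.last p) ∘L nablaExt e p n) ∘L
    ContinuousLinearMap.lpPairing (lebPow p) 2 2 (tauForm e n) ∘L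
    timeRev p ∘L sliceL 0 ∘L nablaExt e p n

lemma slicePairing_apply (p n : ℕ) (ξ η : Fock) :
    slicePairing e p n ξ η = ContinuousLinearMap.lpPairing (lebPow p) 2 2 (tauForm e n)
      (timeRev p (sliceL 0 (nablaExt e p n ξ))) (sliceL (Fin.last p) (nablaExt e p n η)) := rfl

/-- The trace against a Wick product is a scalar product with the reversed tensor, and the adjoint
of the slice inserts that tensor on leg `j`; the integral becomes a scalar product of
multiprocesses. -/
lemma lpPairing_simpleProc {p n : ℕ} (h : Fin p → RealL2) {u : List RealL2} (hu : u.length ≤ n)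
    (j : Fin (p + 1)) (η : Fock) :
    ContinuousLinearMap.lpPairing (lebPow p) 2 2 (tauForm e n) (simpleProc h (tens u))
      (sliceL j (nablaExt e p n η))
      = inner ℂ (elementary h (Function.update (fun _ => vacuum) j (tens u.reverse)))
        (nablaExt e p n η) := by
  rw [← inner_simpleProc_sliceL, ContinuousLinearMap.lpPairing_eq_integral, L2.inner_def]
  refine integral_congr_ae ?_
  filter_upwards [coeFn_simpleProc h (tens u), coeFn_simpleProc h (tens u.reverse),
    coeFn_sliceL j (nablaExt e p n η), wickVac_slice e p n j η] with t h1 h2 h3 h4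
  rw [h1, h2, h3, map_smul, smul_apply, tauForm_tens e hu, h4, inner_smul_left, map_prod]
  simp only [Complex.conj_ofReal, smul_eq_mul]

lemma slicePairing_bvec {p n : ℕ} {v : List ι} (hp : p ≤ v.length) (hv : v.length ≤ n) :
    slicePairing e p n (bvec e v) = tauForm e n (bvec e v) := by
  refine ext_bvec e fun w => ?_
  rw [slicePairing_apply, tauForm, ← tauForm, show bvec e v = tens (v.map e) from rfl,
    tauForm_tens e (by simpa using hv), show tens (v.map e) = bvec e v from rfl,
    nablaExt_bvec, wickVac_bvec, nablaBasis, if_pos hv]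
  by_cases hw : w.length ≤ n
  · rw [if_pos hw, ← ContinuousLinearMap.flip_apply (ContinuousLinearMap.lpPairing (lebPow p) 2 2
      (tauForm e n)), nablaTens, map_list_sum, map_list_sum, map_list_sum]
    simp only [List.map_map, Function.comp_def, sliceL_elementary, map_smul,
      ContinuousLinearMap.flip_apply, timeRev_simpleProc]
    -- Each cut contributes its vacuum weight times the same target, and the weights sum to 1
    -- because p ≤ |v|.
    rw [List.map_congr_left (g := fun d => (∏ i : Fin p, inner ℂ vacuum (tens (d.2 i.succ)))
      * inner ℂ (tens (v.map e).reverse) (bvec e w)) fun d hd => ?_]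
    · rw [List.sum_map_mul_right, sum_iterCuts_vacuum_succ, List.length_map, if_pos hp, one_mul]
    · have hg := glue_of_mem_iterCuts hd
      have hl : (d.2 0).length ≤ n := by
        refine (length_le_length_glue p d.1 d.2 0).trans ?_
        rw [hg]
        simpa using hv
      have hprod : ∏ i ∈ Finset.univ.erase (0 : Fin (p + 1)), inner ℂ vacuum (tens (d.2 i))
          = ∏ i : Fin p, inner ℂ vacuum (tens (d.2 i.succ)) := by
        rw [Fin.univ_succ, Finset.erase_cons, Finset.prod_map]
        rfl
      rw [hprod, lpPairing_simpleProc e _ hl, nablaExt_bvec, nablaBasis, if_pos hw, smul_eq_mul]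
      -- If the later legs are empty, `v` is the first leg followed by the deleted letters, and
      -- gluing the reversed letters to the reversed leg gives the reverse of `v`. Otherwise the
      -- weight is zero.
      by_cases hnil : ∀ i : Fin p, d.2 i.succ = []
      · congr 1
        have hx : Function.update (fun _ => vacuum) (Fin.last p) (tens (d.2 0).reverse)
            = fun j => tens (Function.update (fun _ => []) (Fin.last p) (d.2 0).reverse j) := by
          funext j
          by_cases hj : j = Fin.last p
          · subst hj; simp
          · simp [Function.update_of_ne hj]
        rw [hx, inner_elementary_nablaTens, glue_update_last, bvec, ← hg,
          glue_of_succ_eq_nil p _ _ hnil, List.reverse_append, ofFn_comp_rev]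
      · push Not at hnil
        obtain ⟨i, hi⟩ := hnil
        rw [Finset.prod_eq_zero (Finset.mem_univ i) (by rw [inner_vacuum_tens, if_neg hi]),
          zero_mul, zero_mul]
  · rw [if_neg hw, nablaExt_bvec, nablaBasis, if_neg hw, map_zero, map_zero, inner_zero_right]

lemma slicePairing_eq_tauForm {p n : ℕ} {S : Set (List ι)}
    (hS : ∀ w ∈ S, p ≤ w.length ∧ w.length ≤ n) {ξ : Fock}
    (hξ : ξ ∈ (Submodule.span ℂ (bvec e '' S)).topologicalClosure) :
    slicePairing e p n ξ = tauForm e n ξ := by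
  have : Submodule.span ℂ (bvec e '' S) ≤ LinearMap.ker
      ((slicePairing e p n - tauForm e n)).toLinearMap := by
    refine Submodule.span_le.2 ?_
    rintro _ ⟨w, hw, rfl⟩
    refine LinearMap.mem_ker.2 (sub_eq_zero.2 ?_)
    exact slicePairing_bvec e (hS w hw).1 (hS w hw).2
  exact sub_eq_zero.1 (LinearMap.mem_ker.1 (Submodule.topologicalClosure_minimal _ this
    (ContinuousLinearMap.isClosed_ker _) hξ))

/-! ### The homogeneous chaoses -/

lemma inner_bvec_chaosLE {n : ℕ} {w : List ι} (hw : n < w.length) {ξ : Fock}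
    (hξ : ξ ∈ chaosLE n) : inner ℂ (bvec e w) ξ = 0 := by
  have : wordSpan n ≤ LinearMap.ker (innerSL ℂ (bvec e w)).toLinearMap := by
    refine Submodule.span_le.2 ?_
    rintro _ ⟨v, hv, rfl⟩
    have h1 : tensSpan v.length ≤ LinearMap.ker (innerSL ℂ (bvec e w)).toLinearMap := by
      refine Submodule.span_le.2 ?_
      rintro _ ⟨u, hu, rfl⟩
      refine LinearMap.mem_ker.2 ?_
      change inner ℂ (tens _) (tens u) = 0
      rw [inner_tens, wordInner_of_length_ne]
      rw [List.length_map]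
      have : u.length ≤ v.length := hu
      have : v.length ≤ n := hv
      omega
    exact h1 (wordVec_mem_tensSpan v)
  exact LinearMap.mem_ker.1 (Submodule.topologicalClosure_minimal _ this
    (ContinuousLinearMap.isClosed_ker _) hξ)

/-- Longer tensors are orthogonal to 𝒫ₙ because monomials of degree at most n expand in tensors of
order at most n; shorter ones lie in 𝒫ₙ₋₁, to which ℋₙ is orthogonal. -/
lemma inner_bvec_chaos {n : ℕ} {w : List ι} (hw : w.length ≠ n) {ξ : Fock}
    (hξ : ξ ∈ chaos n) : inner ℂ (bvec e w) ξ = 0 := by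
  cases n with
  | zero => exact inner_bvec_chaosLE e (Nat.pos_of_ne_zero hw) hξ
  | succ n =>
    rcases lt_or_gt_of_ne hw with h | h
    · refine (Submodule.mem_orthogonal _ _).1 hξ.2 _ (Submodule.le_topologicalClosure _ ?_)
      have := tens_mem_wordSpan (w.map e)
      rw [List.length_map] at this
      exact wordSpan_mono (Nat.lt_succ_iff.1 h) this
    · exact inner_bvec_chaosLE e h hξ.1

lemma mem_closure_span_of_mem_iSup_chaos {a b : ℕ} {ξ : Fock}
    (hξ : ξ ∈ ⨆ k ∈ Finset.Icc a b, chaos k) :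
    ξ ∈ (Submodule.span ℂ (bvec e '' {w | a ≤ w.length ∧ w.length ≤ b})).topologicalClosure := by
  refine mem_closure_span_bvec e fun w hw => ?_
  have : ⨆ k ∈ Finset.Icc a b, chaos k ≤ LinearMap.ker (innerSL ℂ (bvec e w)).toLinearMap := by
    refine iSup₂_le fun k hk η hη => LinearMap.mem_ker.2 (inner_bvec_chaos e ?_ hη)
    rintro rfl
    exact hw (Finset.mem_Icc.1 hk)
  exact LinearMap.mem_ker.1 (this hξ)

end Basis

end Wigner

end

/-! ### The generalized Cébron formula. -/

open Wigner
theorem mainTheorem10 (p a b : ℕ) (hp : 1 < p) (hpa : p ≤ a) (hab : a ≤ b)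
    (A B : Fock)
    (hA : A ∈ ⨆ k ∈ Finset.Icc a b, chaos k) (hB : B ∈ ⨆ k ∈ Finset.Icc a b, chaos k) :
    IsBoundedElement A ∧ IsBoundedElement B ∧
    ∃ (hdA : A ∈ (nabla p).domain) (hdB : B ∈ (nabla p).domain),
      (∀ᵐ t ∂lebPow p,
        IsBoundedElement (slice 0 (nabla p ⟨A, hdA⟩ (t ∘ Fin.rev))) ∧
        IsBoundedElement (slice (Fin.last p) (nabla p ⟨B, hdB⟩ t))) ∧
      Integrable (fun t => toOp (slice 0 (nabla p ⟨A, hdA⟩ (t ∘ Fin.rev))) *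
        toOp (slice (Fin.last p) (nabla p ⟨B, hdB⟩ t))) (lebPow p) ∧
      tau (toOp A * toOp B) =
        tau (∫ t, toOp (slice 0 (nabla p ⟨A, hdA⟩ (t ∘ Fin.rev))) *
          toOp (slice (Fin.last p) (nabla p ⟨B, hdB⟩ t)) ∂lebPow p) := by
  obtain ⟨s, e, -⟩ := exists_hilbertBasis ℝ RealL2
  have hS : ∀ w ∈ {w : List s | a ≤ w.length ∧ w.length ≤ b}, w.length ≤ b := fun _ h => h.2
  have hAS := mem_closure_span_of_mem_iSup_chaos e hA
  have hBS := mem_closure_span_of_mem_iSup_chaos e hB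
  have hVA := wickVac_of_mem e hS hAS
  have hVB := wickVac_of_mem e hS hBS
  obtain ⟨⟨A', hdA⟩, rfl : A' = A, hDA⟩ :=
    (LinearPMap.mem_graph_iff _).1 (mem_graph_nabla e (p := p) hS hAS)
  obtain ⟨⟨B', hdB⟩, rfl : B' = B, hDB⟩ :=
    (LinearPMap.mem_graph_iff _).1 (mem_graph_nabla e (p := p) hS hBS)
  refine ⟨isBoundedElement_of_wickVac e hVA, isBoundedElement_of_wickVac e hVB, hdA, hdB, ?_⟩
  simp only [hDA, hDB]
  -- The derivative of `A'` is evaluated at reversed times, and time reversal preserves null sets.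
  have hrA := (measurePreserving_rev p).quasiMeasurePreserving.ae (wickVac_slice e p b 0 A')
  have hrB := wickVac_slice e p b (Fin.last p) B'
  set YA := timeRev p (sliceL 0 (nablaExt e p b A')) with hYA
  set YB := sliceL (Fin.last p) (nablaExt e p b B') with hYB
  have hF : (fun t => toOp (slice 0 (nablaExt e p b A' (t ∘ Fin.rev))) *
      toOp (slice (Fin.last p) (nablaExt e p b B' t)))
      =ᵐ[lebPow p] fun t => wickExt e b (YA t) * wickExt e b (YB t) := by
    filter_upwards [hrA, hrB, coeFn_timeRev (sliceL 0 (nablaExt e p b A')),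
      (measurePreserving_rev p).quasiMeasurePreserving.ae
        (coeFn_sliceL 0 (nablaExt e p b A')),
      coeFn_sliceL (Fin.last p) (nablaExt e p b B')] with t h1 h2 h3 h4 h5
    rw [toOp_eq_wickExt e h1, toOp_eq_wickExt e h2, hYA, hYB, h3, h4, h5]
  -- By Haagerup both factors are L² in operator norm, so Hölder makes their product L¹.
  have hint : Integrable (fun t => wickExt e b (YA t) * wickExt e b (YB t)) (lebPow p) :=
    memLp_one_iff_integrable.1
      (MemLp.mul ((wickExt e b).comp_memLp YB) ((wickExt e b).comp_memLp YA))
  refine ⟨?_, hint.congr hF.symm, ?_⟩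
  · filter_upwards [hrA, hrB] with t h1 h2
    exact ⟨isBoundedElement_of_wickVac e h1, isBoundedElement_of_wickVac e h2⟩
  · rw [integral_congr_ae hF, toOp_eq_wickExt e hVA, toOp_eq_wickExt e hVB, ← tauForm_apply,
      ← slicePairing_eq_tauForm e (p := p) (fun w hw => ⟨hpa.trans hw.1, hw.2⟩) hAS,
      slicePairing_apply, ContinuousLinearMap.lpPairing_eq_integral]
    -- The trace is a bounded functional on operators, so it commutes with the Bochner integral.
    exact (innerSL ℂ vacuum ∘L ContinuousLinearMap.apply ℂ Fock vacuum).integral_comp_comm hint
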